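/- Let $1<r<p<2$. A $p$-stable distribution is a probability law $\mathcal D_p$ on $\mathbb R$, not the point mass at $0$, such that for all $k\ge 1$ and $x\in\mathbb R^k$, if $Z_1,\dots,Z_k,Z\sim\mathcal D_p$ and $Z_1,\dots,Z_k$ are independent, then $\sum_j x_jZ_j$ has the same law as $\|x\|_pZ$. Put $\alpha_{p,r}=(\mathbb E|Z|^r)^{1/r}$ for $Z\sim \mathcal D_p$. There is a constant $C>0$ depending only on $p$ and $r$ such that for all constants $\delta\in(0,1)$ and $b>0$ there is a constant $K>0$ depending only on $p,r,\delta,b$ such that for every constant $L$ there is $c\in\mathbb N$ depending only on $p,r,\delta,b,L$ for which the following holds. Let $\varepsilon\in(0,1)$, $n\ge 0$, $d\ge2$, $A\in\mathbb R^{n\times d}$, let the number of rows $m\in\mathbb N$ satisfy $$K\,\frac{d\log d}{\varepsilon^{C}}\le m\le L\,\frac{d\log d}{\varepsilon^{L}}$$ (for instance $m=\lceil K d\log d/\varepsilon^{C}\rceil$, when $L\ge \max(K+1,C)$; or, for $\varepsilon\le 1/2$, $m=\lceil d\log d/\varepsilon^{C'}\rceil$ with a large enough constant $C'$), and let $T\in\mathbb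 R^{m\times n}$ be a random matrix whose entries are i.i.d. random variables with law $\mathcal D_p$, each multiplied by $1/(m^{1/r}\alpha_{p,r})$. Then: 1. (dilation) for each fixed $x\in\mathbb R^d$, $\ \|TAx\|_r\le(1+\varepsilon)\|Ax\|_p$ with probability at least $1-\delta$; 2. (contraction) with probability at least $1-d^{-b}$, $\ \|TAx\|_r\ge(1-\varepsilon)\|Ax\|_p$ for all $x\in\mathbb R^d$ simultaneously. Moreover, for every $0<\eta\le(\varepsilon/(nd))^{c}$ (when $n\geq 1$), 1 and 2 also hold for the matrix obtained from $T$ by rounding every entry to the nearest integer multiple of $\eta$. In particular, when $\varepsilon\ge 1/\mathrm{poly}(nd)$, a rounding precision of $1/\mathrm{poly}(nd)$ suffices. -/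

import Mathlib

open MeasureTheory ProbabilityTheory

noncomputable section

/-- The `ℓ_p` norm of a finite real vector (Mathlib's `PiLp` norm), for a real exponent `p`. -/
def ellNorm {ι : Type*} [Fintype ι] (p : ℝ) (y : ι → ℝ) : ℝ :=
  ‖(WithLp.toLp (ENNReal.ofReal p) y : PiLp (ENNReal.ofReal p) fun _ : ι => ℝ)‖

theorem ellNorm_eq {ι : Type*} [Fintype ι] {p : ℝ} (hp : 0 < p) (y : ι → ℝ) :
    ellNorm p y = (∑ i, |y i| ^ p) ^ (1 / p) := by
  have h : (ENNReal.ofReal p).toReal = p := ENNReal.toReal_ofReal hp.le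
  unfold ellNorm
  rw [PiLp.norm_eq_sum (by rw [h]; exact hp), h]
  simp [Real.norm_eq_abs]

/-- `μ` is a `p`-stable distribution `𝒟_p`: if `Z₁, …, Zₙ, Z` have law `μ` and `Z₁, …, Zₙ` are
independent, then `∑ⱼ Zⱼ xⱼ` has the same law as `‖x‖_p Z`.  The point mass at `0`, which has this
property for trivial reasons, is excluded.  (The distribution is unique up to a scaling factor.) -/
structure IsPStable (p : ℝ) (μ : Measure ℝ) : Prop where
  isProbabilityMeasure : IsProbabilityMeasure μ
  ne_dirac : μ ≠ Measure.dirac 0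
  stable : ∀ n : ℕ, 0 < n → ∀ x : Fin n → ℝ,
    (Measure.pi fun _ : Fin n => μ).map (fun z => ∑ j, z j * x j) =
      μ.map (fun z => ellNorm p x * z)

/-- `α_{p,r} = (𝔼 |Z|^r)^{1/r}` for `Z` with law `μ`. -/
def momentConst (r : ℝ) (μ : Measure ℝ) : ℝ :=
  (∫ z, |z| ^ r ∂μ) ^ (1 / r)

/-- The matrix with entries `Θᵢⱼ / (m^{1/r} α)`. -/
def scaledMatrix {m n : ℕ} (r α : ℝ) (Θ : Fin m → Fin n → ℝ) : Matrix (Fin m) (Fin n) ℝ :=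
  Matrix.of fun i j => Θ i j / ((m : ℝ) ^ (1 / r) * α)

/-- Every entry is rounded to the nearest integer multiple of `η`. -/
def roundMatrix {m n : ℕ} (η : ℝ) (T : Matrix (Fin m) (Fin n) ℝ) : Matrix (Fin m) (Fin n) ℝ :=
  Matrix.of fun i j => (round (T i j / η) : ℝ) * η

/-- The random matrix `T` is a lopsided `(1 ± ε)`-embedding of the column span of `A` from `ℓ_p`
into `ℓ_r`: it dilates each fixed vector by at most `1 + ε` with probability at least `1 - δ₁`,
and with probability at least `1 - δ₂` it contracts no vector by more than `1 - ε`. -/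
structure IsLopsidedEmbedding {Ω : Type*} [MeasurableSpace Ω] {m n d : ℕ} (P : Measure Ω)
    (T : Ω → Matrix (Fin m) (Fin n) ℝ) (A : Matrix (Fin n) (Fin d) ℝ)
    (p r ε δ₁ δ₂ : ℝ) : Prop where
  dilation : ∀ x : Fin d → ℝ,
    1 - δ₁ ≤ P.real {ω | ellNorm r ((T ω * A).mulVec x) ≤ (1 + ε) * ellNorm p (A.mulVec x)}
  contraction :
    1 - δ₂ ≤ P.real {ω | ∀ x : Fin d → ℝ,
      (1 - ε) * ellNorm p (A.mulVec x) ≤ ellNorm r ((T ω * A).mulVec x)}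

end

/-!
Stability makes each entry of `T y` a copy of `‖y‖_p Z`, up to scaling, so for a fixed vector `y`
the ratio `(‖T y‖_r / ‖y‖_p) ^ r` is the mean of `m` independent copies of `W = (|Z| / α) ^ r`.
This variable has mean one and, as `r < p`, a finite moment of some order `q ∈ (1, 2]` with
`r * q < p`.

The moment bound (`IsPStable.exists_moment_bound`) is needed uniformly over all `p`-stable laws.
The characteristic function `φ` of `Z` is real and satisfies `φ (N ^ (1 / p) * t) = φ t ^ N`.  If
`σ` is a point with `φ σ = 1 / 2`, this gives `1 - φ t ≤ 2 * (|t| / σ) ^ p`, hence the tail bound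
`P (σ |Z| > s) = O(s ^ (-p))` and upper bounds for the moments of order less than `p`; the equality
`1 / 2 = E (1 - cos (σ Z))` bounds the `r`-th moment from below.  Both are in terms of the scale
`σ`, which cancels in the moments of `W`.

With `Q = q / (q - 1)`, Cramér's method and `exp (-u) ≤ 1 - u + u ^ q` show that the mean of `m`
copies of `W` is below `1 - ε` with probability at most `exp (-c * m * ε ^ Q)`.  Above one there is
no exponential bound, but truncation of the summands shows that the mean exceeds `1 + ε` with
probability at most `δ` once `m ≥ K / ε ^ Q`.  The latter is the dilation bound.

For the contraction bound, take an Auerbach basis `u` of the column space of `A`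
(`exists_auerbach_basis`): vectors of norm at most one such that the coordinates of each `y` in the
column space are at most `‖y‖_p` in absolute value.  By Markov's inequality and a union bound, all
`‖T (u j)‖_r` are at most `D = 2 * d ^ (b + 1)` with probability at least `1 - d ^ (-b) / 2`.  This
crude bound suffices to pass from a grid of mesh `ε / (4 * d * D)` to all vectors
(`le_ellNorm_mulVec_of_grid`).  The grid has
`exp (O(d * log d / ε))` points, so the exponential lower-tail bound survives a union bound if
`m ≥ K * d * log d / ε ^ (Q + 1)`.

Rounding changes `T y` by at most `m * n * η / 2 * ‖y‖_p` in `ℓ_r`, whatever `T` is, and this is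
at most `ε / 2 * ‖y‖_p` because `m` is polynomial in `d / ε`.  So everything is proved with `ε / 2`
in place of `ε`.
-/

/-! ### The `ℓ_p` norm -/

lemma ellNorm_nonneg {ι : Type*} [Fintype ι] {p : ℝ} (y : ι → ℝ) (hp : 0 < p) :
    0 ≤ ellNorm p y := by
  rw [ellNorm_eq hp]; positivity

lemma ellNorm_zero {ι : Type*} [Fintype ι] {p : ℝ} (hp : 0 < p) :
    ellNorm p (0 : ι → ℝ) = 0 := by
  simp [ellNorm_eq hp, Real.zero_rpow hp.ne', Real.zero_rpow (inv_ne_zero hp.ne')]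

lemma ellNorm_rpow {ι : Type*} [Fintype ι] {p : ℝ} (hp : 0 < p) (y : ι → ℝ) :
    ellNorm p y ^ p = ∑ i, |y i| ^ p := by
  rw [ellNorm_eq hp, ← Real.rpow_mul (by positivity), one_div_mul_cancel hp.ne', Real.rpow_one]

section Norm

variable {ι : Type*} [Fintype ι] {p : ℝ}

lemma ellNorm_smul (hp : 1 ≤ p) (c : ℝ) (y : ι → ℝ) : ellNorm p (c • y) = |c| * ellNorm p y := by
  have : Fact (1 ≤ ENNReal.ofReal p) := ⟨by simpa using hp⟩
  simp only [ellNorm, WithLp.toLp_smul, norm_smul, Real.norm_eq_abs]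

lemma ellNorm_add_le (hp : 1 ≤ p) (y z : ι → ℝ) :
    ellNorm p (y + z) ≤ ellNorm p y + ellNorm p z := by
  have : Fact (1 ≤ ENNReal.ofReal p) := ⟨by simpa using hp⟩
  simp only [ellNorm, WithLp.toLp_add]
  exact norm_add_le _ _

lemma ellNorm_sum_le (hp : 1 ≤ p) {κ : Type*} (s : Finset κ) (y : κ → ι → ℝ) :
    ellNorm p (∑ k ∈ s, y k) ≤ ∑ k ∈ s, ellNorm p (y k) := by
  have : Fact (1 ≤ ENNReal.ofReal p) := ⟨by simpa using hp⟩
  simp only [ellNorm, WithLp.toLp_sum]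
  exact norm_sum_le _ _

lemma abs_le_ellNorm (hp : 1 ≤ p) (y : ι → ℝ) (i : ι) : |y i| ≤ ellNorm p y := by
  have : Fact (1 ≤ ENNReal.ofReal p) := ⟨by simpa using hp⟩
  exact PiLp.norm_apply_le (WithLp.toLp (ENNReal.ofReal p) y : PiLp _ fun _ : ι => ℝ) i

lemma ellNorm_pos (hp : 1 ≤ p) {y : ι → ℝ} (hy : y ≠ 0) : 0 < ellNorm p y := by
  obtain ⟨i, hi⟩ := Function.ne_iff.1 hy
  exact (abs_pos.2 hi).trans_le (abs_le_ellNorm hp y i)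

end Norm

lemma ellNorm_le_card_mul {ι : Type*} [Fintype ι] {r t : ℝ} (hr : 1 ≤ r)
    {v : ι → ℝ} (hv : ∀ i, |v i| ≤ t) : ellNorm r v ≤ Fintype.card ι * t := by
  have hr0 : 0 < r := by linarith
  classical
  have h1 : v = ∑ i, Pi.single i (v i) := (Finset.univ_sum_single v).symm
  have h2 : ∀ i, ellNorm r (Pi.single i (v i) : ι → ℝ) ≤ t := fun i => by
    refine le_trans (le_of_eq ?_) (hv i)
    rw [ellNorm_eq hr0, Finset.sum_eq_single i]
    · rw [Pi.single_eq_same, ← Real.rpow_mul (abs_nonneg _), mul_one_div_cancel hr0.ne',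
        Real.rpow_one]
    · intro j _ hj
      rw [Pi.single_eq_of_ne hj, abs_zero, Real.zero_rpow hr0.ne']
    · simp
  rw [h1]
  refine (ellNorm_sum_le hr _ _).trans ((Finset.sum_le_sum fun i _ => h2 i).trans ?_)
  simp

lemma ellNorm_const_one {p : ℝ} (hp : 0 < p) (N : ℕ) :
    ellNorm p (fun _ : Fin N => (1 : ℝ)) = (N : ℝ) ^ (1 / p) := by
  simp [ellNorm_eq hp]

/-! ### Characteristic functions and moments of stable laws -/

lemma one_sub_cos_le_two_mul_abs_rpow {κ : ℝ} (hκ : 0 < κ) (hκ2 : κ ≤ 2) (u : ℝ) :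
    1 - Real.cos u ≤ 2 * |u| ^ κ := by
  rcases le_total 1 |u| with hu | hu
  · have := Real.one_le_rpow hu hκ.le
    linarith [Real.neg_one_le_cos u]
  · have h1 := Real.one_sub_sq_div_two_le_cos (x := u)
    have h2 : |u| ^ (2 : ℝ) ≤ |u| ^ κ := Real.rpow_le_rpow_of_exponent_ge'
      (abs_nonneg u) hu hκ.le hκ2
    rw [Real.rpow_two, sq_abs] at h2
    nlinarith [sq_nonneg u]

namespace IsPStable

variable {p : ℝ} {μ : Measure ℝ}

lemma prod_charFun (h : IsPStable p μ) {N : ℕ} (hN : 0 < N) (x : Fin N → ℝ) (t : ℝ) :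
    ∏ j, charFun μ (x j * t) = charFun μ (ellNorm p x * t) := by
  have := h.isProbabilityMeasure
  have hind : iIndepFun (fun (j : Fin N) (z : Fin N → ℝ) => x j * z j)
      (Measure.pi fun _ : Fin N => μ) :=
    iIndepFun_pi (μ := fun _ : Fin N => μ) (X := fun j z => x j * z) (fun j => by fun_prop)
  have h1 := congrFun (hind.charFun_map_fun_sum_eq_prod fun j =>
    ((measurable_pi_apply j).const_mul _).aemeasurable) t
  have h2 : ∀ j : Fin N, (Measure.pi fun _ : Fin N => μ).map (fun z => x j * z j)
      = μ.map (fun z => x j * z) := fun j => by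
    rw [← (measurePreserving_eval (fun _ : Fin N => μ) j).map_eq, Measure.map_map (by fun_prop)
      (by fun_prop), (measurePreserving_eval (fun _ : Fin N => μ) j).map_eq]
    rfl
  simp only [Finset.prod_apply, h2, charFun_map_mul] at h1
  rw [← h1, ← charFun_map_mul, ← h.stable N hN x]
  simp only [mul_comm]

/-- Stability under multiplication by `-1` means that the law is symmetric. -/
lemma charFun_eq_re (h : IsPStable p μ) (hp : 0 < p) (t : ℝ) :
    charFun μ t = ((charFun μ t).re : ℂ) := by
  have := h.prod_charFun one_pos (fun _ => -1) t
  have h1 : ellNorm p (fun _ : Fin 1 => (-1 : ℝ)) = 1 := by simp [ellNorm_eq hp]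
  rw [h1] at this
  simp only [Finset.univ_unique, Finset.prod_const, Finset.card_singleton, pow_one, neg_mul,
    one_mul, charFun_neg] at this
  exact (Complex.conj_eq_iff_re.mp this).symm

lemma re_charFun_pow (h : IsPStable p μ) (hp : 0 < p) {N : ℕ} (hN : 0 < N) (t : ℝ) :
    (charFun μ ((N : ℝ) ^ (1 / p) * t)).re = (charFun μ t).re ^ N := by
  have := h.prod_charFun hN (fun _ => 1) t
  rw [ellNorm_const_one hp] at this
  rw [← this]
  simp only [one_mul, Finset.prod_const, Finset.card_univ, Fintype.card_fin]
  rw [h.charFun_eq_re hp t]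
  norm_cast

lemma re_charFun_mul (h : IsPStable p μ) (hp : 0 < p) {a b : ℝ} (ha : 0 ≤ a) (hb : 0 ≤ b) :
    (charFun μ ((a ^ p + b ^ p) ^ (1 / p))).re = (charFun μ a).re * (charFun μ b).re := by
  have := h.prod_charFun two_pos ![a, b] 1
  simp only [Fin.prod_univ_two, Matrix.cons_val_zero, Matrix.cons_val_one, mul_one,
    ellNorm_eq hp, Fin.sum_univ_two, abs_of_nonneg ha, abs_of_nonneg hb] at this
  rw [← this, h.charFun_eq_re hp a, h.charFun_eq_re hp b]
  norm_cast

lemma re_charFun_le_one (h : IsPStable p μ) (t : ℝ) : (charFun μ t).re ≤ 1 := by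
  have := h.isProbabilityMeasure
  exact (Complex.re_le_norm _).trans (norm_charFun_le_one t)

lemma re_charFun_nonneg (h : IsPStable p μ) (hp : 0 < p) (t : ℝ) : 0 ≤ (charFun μ t).re := by
  have := h.re_charFun_pow hp two_pos (((2 : ℕ) : ℝ) ^ (1 / p))⁻¹ |>.symm
  have h2 := h.re_charFun_pow hp two_pos ((((2 : ℕ) : ℝ) ^ (1 / p))⁻¹ * t)
  rw [← mul_assoc, mul_inv_cancel₀ (by positivity), one_mul] at h2
  rw [h2]; positivity

/-- The characteristic function is nonincreasing on `[0, ∞)`: for `0 ≤ a ≤ b`, its value at `b` is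
its value at `a` times its value at `(b ^ p - a ^ p) ^ (1 / p)`. -/
lemma re_charFun_anti (h : IsPStable p μ) (hp : 0 < p) {a b : ℝ} (ha : 0 ≤ a) (hab : a ≤ b) :
    (charFun μ b).re ≤ (charFun μ a).re := by
  have h0 : 0 ≤ b ^ p - a ^ p := sub_nonneg.2 (Real.rpow_le_rpow ha hab hp.le)
  have := h.re_charFun_mul hp ha (Real.rpow_nonneg h0 (1 / p))
  rw [← Real.rpow_mul h0, one_div_mul_cancel hp.ne', Real.rpow_one, add_sub_cancel,
    ← Real.rpow_mul (ha.trans hab), mul_one_div_cancel hp.ne', Real.rpow_one] at this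
  rw [this]
  exact mul_le_of_le_one_right (h.re_charFun_nonneg hp a) (h.re_charFun_le_one _)

lemma exists_re_charFun_lt_one (h : IsPStable p μ) (hp : 0 < p) :
    ∃ t : ℝ, 0 < t ∧ (charFun μ t).re < 1 := by
  have := h.isProbabilityMeasure
  by_contra! hcon
  apply h.ne_dirac
  apply Measure.ext_of_charFun
  have hpos : ∀ t : ℝ, 0 < t → charFun μ t = 1 := fun t ht => by
    rw [h.charFun_eq_re hp, le_antisymm (h.re_charFun_le_one t) (hcon t ht)]; simp
  ext t
  rw [charFun_dirac, inner_zero_left]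
  simp only [Complex.ofReal_zero, zero_mul, Complex.exp_zero]
  rcases lt_trichotomy t 0 with ht | rfl | ht
  · rw [← neg_neg t, charFun_neg, hpos _ (by linarith)]; simp
  · simp
  · exact hpos t ht

/-- The scale `σ` of a stable law: a point where the characteristic function equals `1 / 2`.  The
functional equation `φ (N ^ (1 / p) * t) = φ t ^ N` controls `1 - φ` near the origin in terms of
`σ` alone. -/
lemma exists_scale (h : IsPStable p μ) (hp : 0 < p) :
    ∃ σ : ℝ, 0 < σ ∧ (charFun μ σ).re = 1 / 2 ∧
      ∀ t : ℝ, ‖1 - charFun μ t‖ ≤ 2 * (|t| / σ) ^ p := by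
  have := h.isProbabilityMeasure
  obtain ⟨t₀, ht₀, hlt⟩ := h.exists_re_charFun_lt_one hp
  obtain ⟨N, hN⟩ := exists_pow_lt_of_lt_one (show (0 : ℝ) < 1 / 2 by norm_num) hlt
  have hN0 : 0 < N := Nat.pos_of_ne_zero (by rintro rfl; norm_num at hN)
  rw [← h.re_charFun_pow hp hN0] at hN
  have hT : 0 ≤ (N : ℝ) ^ (1 / p) * t₀ := by positivity
  have hc : Continuous fun t => (charFun μ t).re := Complex.continuous_re.comp continuous_charFun
  have h0 : (charFun μ 0).re = 1 := by simp
  obtain ⟨σ, hσ, hσ2⟩ := intermediate_value_Icc' hT hc.continuousOn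
    (show (1 / 2 : ℝ) ∈ Set.Icc _ _ from ⟨hN.le, by rw [h0]; norm_num⟩)
  have hσ2 : (charFun μ σ).re = 1 / 2 := hσ2
  have hσ0 : 0 < σ := lt_of_le_of_ne hσ.1 (by rintro rfl; rw [h0] at hσ2; norm_num at hσ2)
  refine ⟨σ, hσ0, hσ2, ?_⟩
  have key : ∀ t : ℝ, 0 ≤ t → 1 - (charFun μ t).re ≤ 2 * (t / σ) ^ p := by
    intro t ht
    rcases ht.eq_or_lt with rfl | ht
    · rw [h0, zero_div, Real.zero_rpow hp.ne']; norm_num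
    rcases le_or_gt σ t with hst | hst
    · have h1 : 1 ≤ (t / σ) ^ p := Real.one_le_rpow ((one_le_div hσ0).2 hst) hp.le
      linarith [h.re_charFun_nonneg hp t]
    -- `t ≤ σ / N ^ (1 / p)` for `N = ⌊(σ / t) ^ p⌋`, and `φ (σ / N ^ (1 / p)) ^ N = 1 / 2`
    set y := (σ / t) ^ p with hy
    have hy1 : 1 ≤ y := Real.one_le_rpow ((one_le_div ht).2 hst.le) hp.le
    set n := ⌊y⌋₊
    have hn1 : 1 ≤ n := Nat.one_le_floor_iff _ |>.2 hy1
    have hn1' : (1 : ℝ) ≤ n := by exact_mod_cast hn1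
    have hny : (n : ℝ) ≤ y := Nat.floor_le (by linarith)
    have hyn : y < n + 1 := Nat.lt_floor_add_one y
    have hts : t ≤ ((n : ℝ) ^ (1 / p))⁻¹ * σ := by
      have h1 : (n : ℝ) ^ (1 / p) ≤ σ / t := by
        calc (n : ℝ) ^ (1 / p) ≤ y ^ (1 / p) := by gcongr
          _ = σ / t := by
            rw [hy, ← Real.rpow_mul (by positivity), mul_one_div_cancel hp.ne', Real.rpow_one]
      rw [inv_mul_eq_div, le_div_iff₀ (by positivity), mul_comm]
      exact (le_div_iff₀ ht).1 h1
    have h2 := h.re_charFun_anti hp ht.le hts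
    set x := (charFun μ (((n : ℝ) ^ (1 / p))⁻¹ * σ)).re with hx
    have hxn : x ^ n = 1 / 2 := by
      rw [hx, ← h.re_charFun_pow hp hn1, ← mul_assoc, mul_inv_cancel₀ (by positivity), one_mul, hσ2]
    have hx0 : 0 ≤ x := h.re_charFun_nonneg hp _
    have h3 : 1 - 1 / (n : ℝ) ≤ x := by
      by_contra! hlt
      have h4 : x ^ n ≤ (1 - 1 / (n : ℝ)) ^ n := by gcongr
      have h5 := Real.one_sub_div_pow_le_exp_neg (n := n) (t := 1) hn1'
      have h6 : Real.exp (-1) < 1 / 2 := by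
        rw [Real.exp_neg, ← one_div]
        exact one_div_lt_one_div_of_lt (by norm_num) (by linarith [Real.exp_one_gt_d9])
      linarith
    have h7 : (t / σ) ^ p = y⁻¹ := by
      rw [hy, ← Real.inv_rpow (by positivity), inv_div]
    rw [h7]
    have h8 : 1 / (n : ℝ) ≤ 2 * y⁻¹ := by
      rw [← div_eq_mul_inv, div_le_div_iff₀ (by linarith) (by linarith)]; linarith
    linarith
  intro t
  have h1 : ‖1 - charFun μ t‖ = 1 - (charFun μ |t|).re := by
    have h2 : (charFun μ |t|).re = (charFun μ t).re := by
      rcases abs_choice t with h' | h' <;> rw [h']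
      rw [charFun_neg, Complex.conj_re]
    rw [h2, h.charFun_eq_re hp t, ← Complex.ofReal_one, ← Complex.ofReal_sub, Complex.norm_real,
      Complex.ofReal_re, Real.norm_of_nonneg (by linarith [h.re_charFun_le_one t])]
  rw [h1]
  exact key _ (abs_nonneg t)

lemma measureReal_abs_gt_le [IsProbabilityMeasure μ] {σ : ℝ} (hp : 0 < p) (hσ : 0 < σ)
    (hb : ∀ t : ℝ, ‖1 - charFun μ t‖ ≤ 2 * (|t| / σ) ^ p) {s : ℝ} (hs : 0 < s) :
    μ.real {x | s < σ * |x|} ≤ 4 * 2 ^ p * s ^ (-p) := by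
  have h0 : {x : ℝ | s < σ * |x|} = {x | s / σ < |x|} := by
    ext x; simp [div_lt_iff₀ hσ, mul_comm]
  have hsσ : 0 < s / σ := by positivity
  rw [h0]
  refine (measureReal_abs_gt_le_integral_charFun hsσ).trans ?_
  have h1 := intervalIntegral.norm_integral_le_of_norm_le_const (a := -2 * (s / σ)⁻¹)
    (b := 2 * (s / σ)⁻¹) (f := fun t => 1 - charFun μ t)
    (C := 2 * (2 / s) ^ p) (fun t ht => by
      refine (hb t).trans ?_
      rw [Set.uIoc_of_le (by have : 0 < (s / σ)⁻¹ := by positivity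
                             linarith)] at ht
      have : |t| ≤ 2 * (s / σ)⁻¹ := abs_le.2 ⟨by linarith [ht.1], ht.2⟩
      have h3 : |t| / σ ≤ 2 / s := by
        rw [div_le_iff₀ hσ]
        refine this.trans (le_of_eq ?_)
        field_simp
      gcongr)
  calc _ ≤ 2⁻¹ * (s / σ) * (2 * (2 / s) ^ p * |2 * (s / σ)⁻¹ - -2 * (s / σ)⁻¹|) := by gcongr
    _ = 4 * 2 ^ p * s ^ (-p) := by
      rw [show 2 * (s / σ)⁻¹ - -2 * (s / σ)⁻¹ = 4 * (s / σ)⁻¹ by ring, abs_of_pos (by positivity),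
        Real.div_rpow (by norm_num) hs.le, Real.rpow_neg hs.le]
      field_simp

/-- Moments of order `κ < p` are bounded in terms of the scale `σ` alone, by integrating the tail
bound. -/
lemma exists_lintegral_rpow_le {κ : ℝ} (hκ : 0 < κ) (hκp : κ < p) :
    ∃ D : ℝ, 0 ≤ D ∧ ∀ (μ : Measure ℝ) [IsProbabilityMeasure μ] (σ : ℝ), 0 < σ →
      (∀ t : ℝ, ‖1 - charFun μ t‖ ≤ 2 * (|t| / σ) ^ p) →
      ∫⁻ z, ENNReal.ofReal ((σ * |z|) ^ κ) ∂μ ≤ ENNReal.ofReal D := by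
  have hp : 0 < p := hκ.trans hκp
  set F : ℝ → ENNReal := fun t =>
    min 1 (ENNReal.ofReal (4 * 2 ^ p * t ^ (-p))) * ENNReal.ofReal (t ^ (κ - 1))
  have hfin : ∫⁻ t in Set.Ioi 0, F t < ⊤ := by
    rw [← Set.Ioc_union_Ioi_eq_Ioi (zero_le_one (α := ℝ))]
    refine (lintegral_union_le _ _ _).trans_lt (ENNReal.add_lt_top.2 ⟨?_, ?_⟩)
    · have h1 : IntegrableOn (fun t : ℝ => t ^ (κ - 1)) (Set.Ioc 0 1) :=
        (intervalIntegrable_iff_integrableOn_Ioc_of_le zero_le_one).1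
          (intervalIntegral.intervalIntegrable_rpow' (by linarith))
      refine lt_of_le_of_lt (setLIntegral_mono' measurableSet_Ioc fun t _ => ?_)
        h1.lintegral_lt_top
      exact (mul_le_mul_left (min_le_left _ _) _).trans (by rw [one_mul])
    · have h1 : IntegrableOn (fun t : ℝ => 4 * 2 ^ p * t ^ (κ - 1 - p)) (Set.Ioi 1) :=
        (integrableOn_Ioi_rpow_of_lt (by linarith) one_pos).const_mul _
      refine lt_of_le_of_lt (setLIntegral_mono' measurableSet_Ioi fun t ht => ?_)
        h1.lintegral_lt_top
      have ht0 : (0 : ℝ) < t := lt_trans one_pos ht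
      refine (mul_le_mul_left (min_le_right _ _) _).trans (le_of_eq ?_)
      rw [← ENNReal.ofReal_mul (by positivity), mul_assoc, ← Real.rpow_add ht0]
      congr 3; ring
  refine ⟨(ENNReal.ofReal κ * ∫⁻ t in Set.Ioi 0, F t).toReal, ENNReal.toReal_nonneg, ?_⟩
  intro μ _ σ hσ hb
  rw [ENNReal.ofReal_toReal (ENNReal.mul_lt_top ENNReal.ofReal_lt_top hfin).ne,
    lintegral_rpow_eq_lintegral_meas_lt_mul μ (ae_of_all _ fun z => by positivity)
      (by fun_prop) hκ]
  refine mul_le_mul_right (setLIntegral_mono' measurableSet_Ioi fun t ht => ?_) _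
  refine mul_le_mul_left (le_min prob_le_one ?_) _
  rw [ENNReal.le_ofReal_iff_toReal_le (measure_ne_top _ _) (by have : (0:ℝ) < t := ht
                                                               positivity)]
  exact measureReal_abs_gt_le hp hσ hb ht

lemma integrable_abs_rpow [IsProbabilityMeasure μ] {σ κ D : ℝ} (hσ : 0 < σ) (hκ : 0 ≤ κ)
    (hD : ∫⁻ z, ENNReal.ofReal ((σ * |z|) ^ κ) ∂μ ≤ ENNReal.ofReal D) :
    Integrable (fun z => (σ * |z|) ^ κ) μ := by
  refine ⟨by fun_prop (disch := assumption), ?_⟩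
  rw [hasFiniteIntegral_iff_ofReal (ae_of_all _ fun z => by positivity)]
  exact hD.trans_lt ENNReal.ofReal_lt_top

/-- The normalised variable `W = (|Z| / α) ^ r` has mean one, and its `q`-th moment is bounded
uniformly over all `p`-stable laws as long as `r * q < p`: the characteristic function bounds
moments of orders `r` and `r * q` from below and above in terms of the same scale. -/
lemma exists_moment_bound {r q : ℝ} (hr : 0 < r) (hr2 : r ≤ 2) (hq : 1 ≤ q) (hrq : r * q < p) :
    ∃ M : ℝ, 0 < M ∧ ∀ μ : Measure ℝ, IsPStable p μ → 0 < momentConst r μ ∧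
      Integrable (fun z => (|z| / momentConst r μ) ^ r) μ ∧
      ∫ z, (|z| / momentConst r μ) ^ r ∂μ = 1 ∧
      Integrable (fun z => ((|z| / momentConst r μ) ^ r) ^ q) μ ∧
      ∫ z, ((|z| / momentConst r μ) ^ r) ^ q ∂μ ≤ M := by
  have hrq0 : 0 < r * q := by positivity
  have hp : 0 < p := hrq0.trans hrq
  have hrp : r < p := lt_of_le_of_lt (le_mul_of_one_le_right hr.le hq) hrq
  obtain ⟨D₁, hD₁, H₁⟩ := exists_lintegral_rpow_le hr hrp
  obtain ⟨D, hD, H⟩ := exists_lintegral_rpow_le hrq0 hrq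
  refine ⟨4 ^ q * D + 1, by positivity, fun μ h => ?_⟩
  have := h.isProbabilityMeasure
  obtain ⟨σ, hσ, hσ2, hb⟩ := h.exists_scale hp
  have I₁ := integrable_abs_rpow hσ hr.le (H₁ μ σ hσ hb)
  have I := integrable_abs_rpow hσ hrq0.le (H μ σ hσ hb)
  have hlow : 1 / 4 ≤ ∫ z, (σ * |z|) ^ r ∂μ := by
    have h1 : (charFun μ σ).re = ∫ z, Real.cos (σ * z) ∂μ := by
      rw [charFun_apply_real, ← RCLike.re_eq_complex_re, ← integral_re]
      · congr 1; ext z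
        rw [RCLike.re_eq_complex_re, ← Complex.ofReal_mul, Complex.exp_ofReal_mul_I_re]
      · refine Integrable.of_bound (C := 1) (by fun_prop) (ae_of_all _ fun z => ?_)
        rw [← Complex.ofReal_mul, Complex.norm_exp_ofReal_mul_I]
    have hc : Integrable (fun z => Real.cos (σ * z)) μ :=
      Integrable.of_bound (C := 1) (by fun_prop) (ae_of_all _ fun z => Real.abs_cos_le_one _)
    have h2 : ∫ z, (1 - Real.cos (σ * z)) ∂μ ≤ ∫ z, 2 * (σ * |z|) ^ r ∂μ := by
      refine integral_mono ((integrable_const _).sub hc) (I₁.const_mul 2) fun z => ?_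
      refine (one_sub_cos_le_two_mul_abs_rpow hr hr2 _).trans (le_of_eq ?_)
      rw [abs_mul, abs_of_pos hσ]
    rw [integral_sub (integrable_const _) hc, ← h1, hσ2, integral_const_mul] at h2
    simp only [integral_const, probReal_univ, smul_eq_mul, mul_one] at h2
    linarith
  have hup : ∫ z, (σ * |z|) ^ (r * q) ∂μ ≤ D := by
    rw [integral_eq_lintegral_of_nonneg_ae (ae_of_all _ fun z => by positivity)
      I.aestronglyMeasurable]
    exact ENNReal.toReal_le_of_le_ofReal hD (H μ σ hσ hb)
  set E := ∫ z, |z| ^ r ∂μ with hE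
  have hEσ : ∫ z, (σ * |z|) ^ r ∂μ = σ ^ r * E := by
    rw [hE, ← integral_const_mul]
    congr 1; ext z; rw [Real.mul_rpow hσ.le (abs_nonneg z)]
  rw [hEσ] at hlow
  have hσr : 0 < σ ^ r := by positivity
  have hE0 : 0 < E := by
    by_contra! hneg
    nlinarith [mul_nonneg hσr.le (neg_nonneg.2 hneg)]
  have hα : momentConst r μ = E ^ (1 / r) := rfl
  have hα0 : 0 < momentConst r μ := by rw [hα]; positivity
  have hαr : momentConst r μ ^ r = E := by
    rw [hα, ← Real.rpow_mul hE0.le, one_div_mul_cancel hr.ne', Real.rpow_one]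
  have hW : ∀ z : ℝ, (|z| / momentConst r μ) ^ r = (σ ^ r * E)⁻¹ * (σ * |z|) ^ r := fun z => by
    rw [Real.div_rpow (abs_nonneg z) hα0.le, hαr, Real.mul_rpow hσ.le (abs_nonneg z)]
    field_simp
  have hWq : ∀ z : ℝ, ((|z| / momentConst r μ) ^ r) ^ q
      = ((σ ^ r * E)⁻¹) ^ q * (σ * |z|) ^ (r * q) := fun z => by
    rw [hW, Real.mul_rpow (by positivity) (by positivity), ← Real.rpow_mul (by positivity)]
  simp only [hWq]
  have hinv : (σ ^ r * E)⁻¹ ≤ 4 := by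
    rw [inv_le_comm₀ (by positivity) (by norm_num)]; linarith
  refine ⟨hα0, ?_, ?_, I.const_mul _, ?_⟩
  · simp only [hW]; exact I₁.const_mul _
  · simp only [hW]
    rw [integral_const_mul, hEσ, inv_mul_cancel₀ (by positivity)]
  · rw [integral_const_mul]
    have h5 : 0 ≤ ∫ z, (σ * |z|) ^ (r * q) ∂μ := integral_nonneg fun z => by positivity
    calc _ ≤ (4 : ℝ) ^ q * D := by gcongr
      _ ≤ _ := by linarith

end IsPStable

/-! ### Tails of sums of independent variables with a finite moment of order `q` -/

/-- `ν` is a law on `[0, ∞)` with mean one and `q`-th moment at most `M`. -/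
structure HasUnitMean (q M : ℝ) (ν : Measure ℝ) : Prop where
  isProbabilityMeasure : IsProbabilityMeasure ν
  nonneg : ∀ᵐ w ∂ν, 0 ≤ w
  integrable : Integrable (fun w => w) ν
  mean : ∫ w, w ∂ν = 1
  integrable_rpow : Integrable (fun w => w ^ q) ν
  moment_le : ∫ w, w ^ q ∂ν ≤ M

lemma exp_neg_le_one_sub_add_rpow {q u : ℝ} (hq : 1 ≤ q) (hq2 : q ≤ 2) (hu : 0 ≤ u) :
    Real.exp (-u) ≤ 1 - u + u ^ q := by
  rcases le_total u 1 with h | h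
  · have h1 := abs_le.1
      (Real.abs_exp_sub_one_sub_id_le (x := -u) (by rwa [abs_neg, abs_of_nonneg hu]))
    have h2 : u ^ (2 : ℝ) ≤ u ^ q := Real.rpow_le_rpow_of_exponent_ge' hu h (by linarith) hq2
    rw [Real.rpow_two] at h2
    nlinarith
  · have h1 := Real.rpow_le_rpow_of_exponent_le h hq
    rw [Real.rpow_one] at h1
    have h2 : Real.exp (-u) ≤ 1 := Real.exp_le_one_iff.2 (by linarith)
    linarith

lemma exp_min_le_one_add_rpow {q u : ℝ} (hq : 1 ≤ q) (hq2 : q ≤ 2) (hu : 0 ≤ u) :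
    Real.exp (min u 1) ≤ 1 + u + u ^ q := by
  rcases le_total u 1 with h | h
  · rw [min_eq_left h]
    have h1 := abs_le.1 (Real.abs_exp_sub_one_sub_id_le (x := u) (by rwa [abs_of_nonneg hu]))
    have h2 : u ^ (2 : ℝ) ≤ u ^ q := Real.rpow_le_rpow_of_exponent_ge' hu h (by linarith) hq2
    rw [Real.rpow_two] at h2
    nlinarith
  · rw [min_eq_right h]
    have h1 := Real.rpow_le_rpow_of_exponent_le h hq
    rw [Real.rpow_one] at h1
    linarith [Real.exp_one_lt_d9]

section Tails

variable {Ω : Type*} [MeasurableSpace Ω] {P : Measure Ω} [IsProbabilityMeasure P] {m : ℕ}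
  {X : Fin m → Ω → ℝ} {ν : Measure ℝ}

/-- Chernoff's bound for a sum of independent variables `g (X i)`. -/
lemma measureReal_le_sum_comp_le (hX : ∀ i, HasLaw (X i) ν P) (hind : iIndepFun X P) {g : ℝ → ℝ}
    (hg : Measurable g) (hint : Integrable (fun w => Real.exp (g w)) ν)
    (hg1 : ∀ᵐ w ∂ν, g w ≤ 1) {a B : ℝ}
    (hB : ∫ w, Real.exp (g w) ∂ν ≤ B) :
    P.real {ω | a ≤ ∑ i, g (X i ω)} ≤ Real.exp (-a) * B ^ m := by
  have hmeas : ∀ i, AEMeasurable (fun ω => g (X i ω)) P := fun i =>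
    hg.comp_aemeasurable (hX i).aemeasurable
  have hind' : iIndepFun (fun i ω => g (X i ω)) P := hind.comp (fun _ => g) fun _ => hg
  have hmgf : ∀ i, mgf (fun ω => g (X i ω)) P 1 = ∫ w, Real.exp (g w) ∂ν := fun i => by
    simp only [mgf, one_mul]
    exact (hX i).integral_comp (f := fun w => Real.exp (g w)) hint.aestronglyMeasurable
  have hsum : Integrable (fun ω => Real.exp (1 * (∑ i, fun ω => g (X i ω)) ω)) P := by
    have hle : ∀ᵐ ω ∂P, ∀ i, g (X i ω) ≤ 1 := ae_all_iff.2 fun i =>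
      ((hX i).ae_iff (p := fun w => g w ≤ 1)
        (measurableSet_setOfPred.1 (measurableSet_le hg measurable_const))).2 hg1
    refine Integrable.of_bound (C := Real.exp (∑ _i : Fin m, (1 : ℝ))) ?_ ?_
    · have := Finset.aemeasurable_sum Finset.univ fun i (_ : i ∈ Finset.univ) => hmeas i
      exact (this.const_mul 1).exp.aestronglyMeasurable
    · filter_upwards [hle] with ω hω
      rw [Real.norm_of_nonneg (Real.exp_pos _).le, Real.exp_le_exp, one_mul, Finset.sum_apply]
      exact Finset.sum_le_sum fun i _ => hω i
  have h := measure_ge_le_exp_mul_mgf a zero_le_one hsum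
  rw [hind'.mgf_sum₀ hmeas] at h
  simp only [hmgf, Finset.prod_const, Finset.card_univ, Fintype.card_fin, Finset.sum_apply] at h
  refine h.trans ?_
  rw [neg_one_mul]
  have h0 : 0 ≤ ∫ w, Real.exp (g w) ∂ν := integral_nonneg fun w => (Real.exp_pos _).le
  gcongr

variable {q M : ℝ}

/-- Cramér's method: `exp (-u) ≤ 1 - u + u ^ q` bounds the Laplace transform of the law, which is
finite although the law has no second moment. -/
lemma HasUnitMean.measureReal_sum_le_of_pos (hν : HasUnitMean q M ν) (hq : 1 ≤ q) (hq2 : q ≤ 2)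
    (hX : ∀ i, HasLaw (X i) ν P) (hind : iIndepFun X P) {l : ℝ} (hl : 0 < l) (ε : ℝ) :
    P.real {ω | ∑ i, X i ω ≤ m * (1 - ε)} ≤ Real.exp (-(m * (l * ε - M * l ^ q))) := by
  have := hν.isProbabilityMeasure
  have hint : Integrable (fun w => Real.exp (-l * w)) ν :=
    Integrable.of_bound (C := 1) (by fun_prop) (hν.nonneg.mono fun w hw => by
      rw [Real.norm_of_nonneg (Real.exp_pos _).le, Real.exp_le_one_iff]; nlinarith)
  have hB : ∫ w, Real.exp (-l * w) ∂ν ≤ Real.exp (-l + M * l ^ q) := by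
    calc ∫ w, Real.exp (-l * w) ∂ν ≤ ∫ w, (1 - l * w + l ^ q * w ^ q) ∂ν := by
          refine integral_mono_ae hint (((integrable_const _).sub (hν.integrable.const_mul l)).add
            (hν.integrable_rpow.const_mul _)) (hν.nonneg.mono fun w hw => ?_)
          have := exp_neg_le_one_sub_add_rpow hq hq2 (mul_nonneg hl.le hw)
          rwa [Real.mul_rpow hl.le hw, ← neg_mul] at this
      _ = 1 - l + l ^ q * ∫ w, w ^ q ∂ν := by
          rw [integral_add (f := fun w => 1 - l * w)
            ((integrable_const _).sub (hν.integrable.const_mul l))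
            (hν.integrable_rpow.const_mul _), integral_sub (integrable_const _)
            (hν.integrable.const_mul l), integral_const_mul, integral_const_mul, hν.mean]
          simp
      _ ≤ 1 - l + l ^ q * M := by gcongr; exact hν.moment_le
      _ ≤ _ := by linarith [Real.add_one_le_exp (-l + M * l ^ q)]
  have h := measureReal_le_sum_comp_le hX hind (g := fun w => -l * w) (by fun_prop) hint
    (hν.nonneg.mono fun w hw => by nlinarith) (a := -l * (m * (1 - ε))) hB
  have hset : {ω | ∑ i, X i ω ≤ m * (1 - ε)} = {ω | -l * (m * (1 - ε)) ≤ ∑ i, -l * X i ω} := by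
    ext ω
    simp only [Set.mem_ofPred_eq, ← Finset.mul_sum]
    exact (mul_le_mul_left_of_neg (by linarith)).symm
  rw [hset]
  refine h.trans (le_of_eq ?_)
  rw [← Real.exp_nat_mul, ← Real.exp_add]
  congr 1; ring

/-- The upper tail is only polynomially small: either some summand exceeds the level `1 / l`, or
the sum truncated at that level is large, which has exponentially small probability. -/
lemma HasUnitMean.measureReal_lt_sum_le_of_pos (hν : HasUnitMean q M ν) (hq : 1 ≤ q) (hq2 : q ≤ 2)
    (hX : ∀ i, HasLaw (X i) ν P) (hind : iIndepFun X P) {l : ℝ} (hl : 0 < l) (ε : ℝ) :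
    P.real {ω | m * (1 + ε) < ∑ i, X i ω} ≤
      m * (M * l ^ q) + Real.exp (-(m * (l * ε - M * l ^ q))) := by
  have := hν.isProbabilityMeasure
  have hint : Integrable (fun w => Real.exp (min (l * w) 1)) ν :=
    Integrable.of_bound (C := Real.exp 1) (by fun_prop) (ae_of_all _ fun w => by
      rw [Real.norm_of_nonneg (Real.exp_pos _).le, Real.exp_le_exp]; exact min_le_right _ _)
  have hB : ∫ w, Real.exp (min (l * w) 1) ∂ν ≤ Real.exp (l + M * l ^ q) := by
    calc ∫ w, Real.exp (min (l * w) 1) ∂ν ≤ ∫ w, (1 + l * w + l ^ q * w ^ q) ∂ν := by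
          refine integral_mono_ae hint (((integrable_const _).add (hν.integrable.const_mul l)).add
            (hν.integrable_rpow.const_mul _)) (hν.nonneg.mono fun w hw => ?_)
          have := exp_min_le_one_add_rpow hq hq2 (mul_nonneg hl.le hw)
          rwa [Real.mul_rpow hl.le hw] at this
      _ = 1 + l + l ^ q * ∫ w, w ^ q ∂ν := by
          rw [integral_add (f := fun w => 1 + l * w)
            ((integrable_const _).add (hν.integrable.const_mul l))
            (hν.integrable_rpow.const_mul _), integral_add (integrable_const _)
            (hν.integrable.const_mul l), integral_const_mul, integral_const_mul, hν.mean]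
          simp
      _ ≤ 1 + l + l ^ q * M := by gcongr; exact hν.moment_le
      _ ≤ _ := by linarith [Real.add_one_le_exp (l + M * l ^ q)]
  have h := measureReal_le_sum_comp_le hX hind (g := fun w => min (l * w) 1) (by fun_prop) hint
    (ae_of_all _ fun w => min_le_right _ _) (a := l * (m * (1 + ε))) hB
  have htail : ∀ i, P.real {ω | 1 ≤ (l * X i ω) ^ q} ≤ M * l ^ q := by
    intro i
    have hms : MeasurableSet {w : ℝ | 1 ≤ (l * w) ^ q} :=
      measurableSet_le measurable_const (by fun_prop)
    rw [(hX i).measureReal_eq hms]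
    have hae : (fun w => (l * w) ^ q) =ᵐ[ν] fun w => l ^ q * w ^ q :=
      hν.nonneg.mono fun w hw => Real.mul_rpow hl.le hw
    have h1 := mul_meas_ge_le_integral_of_nonneg (μ := ν) (f := fun w => (l * w) ^ q)
      (hν.nonneg.mono fun w hw => by positivity)
      ((hν.integrable_rpow.const_mul (l ^ q)).congr hae.symm) 1
    rw [one_mul, integral_congr_ae hae, integral_const_mul] at h1
    refine h1.trans ?_
    rw [mul_comm]
    gcongr
    exact hν.moment_le
  have hsub : {ω | m * (1 + ε) < ∑ i, X i ω} ⊆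
      (⋃ i, {ω | 1 ≤ (l * X i ω) ^ q}) ∪
        {ω | l * (m * (1 + ε)) ≤ ∑ i, min (l * X i ω) 1} := by
    intro ω hω
    by_cases hex : ∃ i, 1 ≤ l * X i ω
    · obtain ⟨i, hi⟩ := hex
      exact Or.inl (Set.mem_iUnion.2 ⟨i, Real.one_le_rpow hi (by linarith)⟩)
    · push Not at hex
      refine Or.inr ?_
      simp only [Set.mem_ofPred_eq] at hω ⊢
      simp only [fun i => min_eq_left (hex i).le, ← Finset.mul_sum]
      exact mul_le_mul_of_nonneg_left hω.le hl.le
  calc _ ≤ P.real ((⋃ i, {ω | 1 ≤ (l * X i ω) ^ q}) ∪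
        {ω | l * (m * (1 + ε)) ≤ ∑ i, min (l * X i ω) 1}) := measureReal_mono hsub
    _ ≤ P.real (⋃ i, {ω | 1 ≤ (l * X i ω) ^ q}) + _ := measureReal_union_le _ _
    _ ≤ (∑ _i : Fin m, M * l ^ q) + Real.exp (-(l * (m * (1 + ε)))) *
        Real.exp (l + M * l ^ q) ^ m :=
      add_le_add ((measureReal_iUnion_fintype_le _).trans (Finset.sum_le_sum fun i _ => htail i)) h
    _ = _ := by
      rw [← Real.exp_nat_mul, ← Real.exp_add]
      simp only [Finset.sum_const, Finset.card_univ, Fintype.card_fin, nsmul_eq_mul]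
      congr 2; ring

lemma HasUnitMean.measureReal_sum_le (hν : HasUnitMean q M ν) (hM : 0 < M) (hq : 1 < q)
    (hq2 : q ≤ 2) (hX : ∀ i, HasLaw (X i) ν P) (hind : iIndepFun X P) {ε : ℝ} (hε : 0 < ε) :
    P.real {ω | ∑ i, X i ω ≤ m * (1 - ε)} ≤
      Real.exp (-((2 * M) ^ (-(1 / (q - 1))) / 2 * (m * ε ^ (q / (q - 1))))) := by
  have hq1 : 0 < q - 1 := by linarith
  -- the choice of `l` makes the error term `M * l ^ q` half of the gain `l * ε`
  set l := (ε / (2 * M)) ^ (1 / (q - 1)) with hl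
  have hl0 : 0 < l := by positivity
  have hlq : l ^ q = l * (ε / (2 * M)) := by
    rw [show q = 1 + (q - 1) by ring, Real.rpow_add hl0, Real.rpow_one]
    congr 1
    rw [hl, ← Real.rpow_mul (by positivity)]
    simp [hq1.ne']
  refine (hν.measureReal_sum_le_of_pos hq.le hq2 hX hind hl0 ε).trans (le_of_eq ?_)
  congr 2
  have h1 : l * ε = (2 * M) ^ (-(1 / (q - 1))) * ε ^ (q / (q - 1)) := by
    rw [hl, Real.div_rpow hε.le (by positivity), Real.rpow_neg (by positivity),
      show q / (q - 1) = 1 / (q - 1) + 1 by field_simp; ring, Real.rpow_add hε, Real.rpow_one]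
    ring
  rw [hlq]
  have h2 : l * ε - M * (l * (ε / (2 * M))) = l * ε / 2 := by field_simp; ring
  rw [h2, h1]; ring

lemma HasUnitMean.exists_measureReal_lt_sum_le (hM : 0 < M) (hq : 1 < q)
    (hq2 : q ≤ 2) {δ : ℝ} (hδ : 0 < δ) (hδ1 : δ < 1) : ∃ K : ℝ, 0 < K ∧ ∀ (ν : Measure ℝ),
      HasUnitMean q M ν → ∀ (Ω : Type*) [MeasurableSpace Ω] (P : Measure Ω) [IsProbabilityMeasure P]
      (m : ℕ) (X : Fin m → Ω → ℝ), (∀ i, HasLaw (X i) ν P) → iIndepFun X P → 0 < m →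
      ∀ ε : ℝ, 0 < ε → K / ε ^ (q / (q - 1)) ≤ m →
      P.real {ω | m * (1 + ε) < ∑ i, X i ω} ≤ δ := by
  have hq1 : 0 < q - 1 := by linarith
  have hlog : 0 < Real.log (2 / δ) := Real.log_pos (by rw [lt_div_iff₀ hδ]; linarith)
  set G := (Real.log (2 / δ) + 1) * (2 * M / δ) ^ (1 / q) with hG
  have hG0 : 0 < G := by positivity
  refine ⟨G ^ (q / (q - 1)), by positivity, ?_⟩
  intro ν hν Ω _ P _ m X hX hind hm ε hε hKm
  have hm0 : (0 : ℝ) < m := by exact_mod_cast hm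
  -- truncation at level `1 / l` has failure probability `δ / 2`
  set l := (δ / (2 * m * M)) ^ (1 / q) with hl
  have hl0 : 0 < l := by positivity
  have hlq : m * (M * l ^ q) = δ / 2 := by
    rw [hl, ← Real.rpow_mul (by positivity), one_div_mul_cancel (by linarith), Real.rpow_one]
    field_simp
  have h := hν.measureReal_lt_sum_le_of_pos hq.le hq2 hX hind hl0 ε
  rw [hlq] at h
  have h1 : Real.log (2 / δ) + 1 ≤ m * (l * ε) := by
    have h2 : G / ε ≤ (m : ℝ) ^ ((q - 1) / q) := by
      have : ((G / ε) ^ (q / (q - 1))) ^ ((q - 1) / q) ≤ (m : ℝ) ^ ((q - 1) / q) := by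
        rw [Real.div_rpow hG0.le hε.le]
        gcongr
      rwa [← Real.rpow_mul (by positivity), show q / (q - 1) * ((q - 1) / q) = 1 by field_simp,
        Real.rpow_one] at this
    have h3 : m * l = (m : ℝ) ^ ((q - 1) / q) / (2 * M / δ) ^ (1 / q) := by
      rw [hl, show δ / (2 * m * M) = (m : ℝ)⁻¹ * (2 * M / δ)⁻¹ by field_simp,
        Real.mul_rpow (by positivity) (by positivity), Real.inv_rpow (by positivity),
        Real.inv_rpow (by positivity), show (q - 1) / q = 1 - 1 / q by field_simp,
        Real.rpow_sub hm0, Real.rpow_one]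
      field_simp
    rw [div_le_iff₀ hε, hG] at h2
    rw [← mul_assoc, h3, div_mul_eq_mul_div, le_div_iff₀ (by positivity)]
    exact h2
  have h4 : Real.exp (-(m * (l * ε - M * l ^ q))) ≤ δ / 2 := by
    rw [mul_sub, hlq, ← Real.le_log_iff_exp_le (by positivity)]
    have : Real.log (δ / 2) = - Real.log (2 / δ) := by rw [← Real.log_inv, inv_div]
    rw [this]; linarith
  linarith

end Tails

/-! ### The sketch of a fixed vector -/

lemma IsPStable.hasUnitMean_map {p r q M : ℝ} {μ : Measure ℝ} (h : IsPStable p μ)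
    (hI : Integrable (fun z => (|z| / momentConst r μ) ^ r) μ)
    (hm : ∫ z, (|z| / momentConst r μ) ^ r ∂μ = 1)
    (hα : 0 < momentConst r μ)
    (hIq : Integrable (fun z => ((|z| / momentConst r μ) ^ r) ^ q) μ)
    (hM : ∫ z, ((|z| / momentConst r μ) ^ r) ^ q ∂μ ≤ M) :
    HasUnitMean q M (μ.map fun z => (|z| / momentConst r μ) ^ r) := by
  have := h.isProbabilityMeasure
  have hmeas : Measurable fun z : ℝ => (|z| / momentConst r μ) ^ r := by fun_prop
  have hqm : Measurable fun w : ℝ => w ^ q := by fun_prop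
  refine ⟨Measure.isProbabilityMeasure_map hmeas.aemeasurable, ?_, ?_, ?_, ?_, ?_⟩
  · rw [ae_map_iff hmeas.aemeasurable measurableSet_Ici]
    exact ae_of_all _ fun z => by positivity
  · exact (integrable_map_measure aestronglyMeasurable_id hmeas.aemeasurable).2 hI
  · exact (integral_map (f := fun w => w) hmeas.aemeasurable aestronglyMeasurable_id).trans hm
  · exact (integrable_map_measure hqm.aestronglyMeasurable hmeas.aemeasurable).2 hIq
  · rw [integral_map hmeas.aemeasurable hqm.aestronglyMeasurable]; exact hM

section Sketch

variable {Ω : Type*} [MeasurableSpace Ω] {P : Measure Ω} {m n : ℕ}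
  {Θ : Fin m → Fin n → Ω → ℝ} {μ : Measure ℝ}

lemma hasLaw_row (hΘ : ∀ i j, HasLaw (Θ i j) μ P)
    (hind : iIndepFun (fun ij : Fin m × Fin n => Θ ij.1 ij.2) P) (i : Fin m) :
    HasLaw (fun ω j => Θ i j ω) (Measure.pi fun _ : Fin n => μ) P := by
  have h1 : iIndepFun (fun j => Θ i j) P :=
    hind.precomp (g := fun j => (i, j)) fun a b hab => (Prod.mk.inj hab).2
  refine ⟨aemeasurable_pi_lambda _ fun j => (hΘ i j).aemeasurable, ?_⟩
  rw [h1.map_fun_eq_pi_map fun j => (hΘ i j).aemeasurable]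
  simp only [(hΘ i _).map_eq]

lemma iIndepFun_rows [IsProbabilityMeasure P] (hμ : IsProbabilityMeasure μ)
    (hΘ : ∀ i j, HasLaw (Θ i j) μ P)
    (hind : iIndepFun (fun ij : Fin m × Fin n => Θ ij.1 ij.2) P) :
    iIndepFun (fun i ω j => Θ i j ω) P := by
  rw [iIndepFun_iff_map_fun_eq_pi_map fun i => (hasLaw_row hΘ hind i).aemeasurable]
  simp only [(hasLaw_row hΘ hind _).map_eq]
  have hae : ∀ ij : Fin m × Fin n, AEMeasurable (Θ ij.1 ij.2) P := fun ij =>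
    (hΘ ij.1 ij.2).aemeasurable
  have h1 := hind.map_fun_eq_pi_map hae
  simp only [(hΘ _ _).map_eq] at h1
  have h2 := Measure.infinitePi_map_curry (fun (_ : Fin m) (_ : Fin n) => μ)
  simp only [Measure.infinitePi_eq_pi] at h2
  rw [← h2, ← h1, AEMeasurable.map_map_of_aemeasurable
    (MeasurableEquiv.measurable _).aemeasurable (aemeasurable_pi_lambda _ hae)]
  rfl

/-- By stability, the normalised entries of the sketch of a nonzero vector are independent copies
of `(|Z| / α) ^ r`. -/
lemma IsPStable.hasLaw_sketch [IsProbabilityMeasure P] {p r : ℝ} (h : IsPStable p μ) (hp : 1 ≤ p)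
    (hΘ : ∀ i j, HasLaw (Θ i j) μ P)
    (hind : iIndepFun (fun ij : Fin m × Fin n => Θ ij.1 ij.2) P) {y : Fin n → ℝ} (hy : y ≠ 0)
    (α : ℝ) :
    (∀ i, HasLaw (fun ω => (|∑ j, Θ i j ω * y j| / (ellNorm p y * α)) ^ r)
      (μ.map fun z => (|z| / α) ^ r) P) ∧
    iIndepFun (fun i ω => (|∑ j, Θ i j ω * y j| / (ellNorm p y * α)) ^ r) P := by
  have hn : 0 < n := by
    rcases Nat.eq_zero_or_pos n with rfl | hn
    · exact absurd (Subsingleton.elim _ _) hy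
    · exact hn
  have hs := ellNorm_pos hp hy
  have hg : Measurable fun z : Fin n → ℝ => (|∑ j, z j * y j| / (ellNorm p y * α)) ^ r := by
    fun_prop
  have hsum : Measurable fun z : Fin n → ℝ => ∑ j, z j * y j := by fun_prop
  constructor
  · intro i
    have hrow := hasLaw_row hΘ hind i
    refine ⟨hg.comp_aemeasurable hrow.aemeasurable, ?_⟩
    have h1 : (Measure.pi fun _ : Fin n => μ).map
        (fun z => (|∑ j, z j * y j| / (ellNorm p y * α)) ^ r) = μ.map fun z => (|z| / α) ^ r := by
      have hG : Measurable fun w : ℝ => (|w| / (ellNorm p y * α)) ^ r := by fun_prop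
      have h2 := Measure.map_map (μ := Measure.pi fun _ : Fin n => μ) hG hsum
      rw [h.stable n hn y, Measure.map_map hG (by fun_prop)] at h2
      refine h2.symm.trans ?_
      congr 1; ext z
      simp only [Function.comp_apply, abs_mul, abs_of_pos hs]
      rw [mul_div_mul_left _ _ hs.ne']
    rw [← h1, ← hrow.map_eq, AEMeasurable.map_map_of_aemeasurable hg.aemeasurable hrow.aemeasurable]
    rfl
  · exact (iIndepFun_rows h.isProbabilityMeasure hΘ hind).comp (fun _ => _) fun _ => hg

lemma ellNorm_scaledMatrix_mulVec_rpow {r α s : ℝ} (hr : 0 < r) (hα : 0 < α) (hs : 0 < s)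
    (hm : 0 < m) (Z : Fin m → Fin n → ℝ) (y : Fin n → ℝ) :
    ellNorm r ((scaledMatrix r α Z).mulVec y) ^ r =
      s ^ r * ((∑ i, (|∑ j, Z i j * y j| / (s * α)) ^ r) / m) := by
  have hm0 : (0 : ℝ) < m := by exact_mod_cast hm
  rw [ellNorm_rpow hr, Finset.sum_div, Finset.mul_sum]
  refine Finset.sum_congr rfl fun i _ => ?_
  have h1 : (scaledMatrix r α Z).mulVec y i = (∑ j, Z i j * y j) / ((m : ℝ) ^ (1 / r) * α) := by
    simp only [Matrix.mulVec, dotProduct, scaledMatrix, Matrix.of_apply, Finset.sum_div]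
    exact Finset.sum_congr rfl fun j _ => by ring
  rw [h1, abs_div, abs_of_pos (by positivity : 0 < (m : ℝ) ^ (1 / r) * α),
    Real.div_rpow (abs_nonneg _) (by positivity), Real.div_rpow (abs_nonneg _) (by positivity),
    Real.mul_rpow (by positivity) hα.le, Real.mul_rpow hs.le hα.le, ← Real.rpow_mul hm0.le,
    one_div_mul_cancel hr.ne', Real.rpow_one]
  have : s ^ r ≠ 0 := by positivity
  have : α ^ r ≠ 0 := by positivity
  field_simp

end Sketch

/-- Bounds for the image of each fixed vector under a random matrix: it is shrunk by more than
`1 - ε` with probability at most `exp (-c * m * ε ^ Q)`, and stretched by more than `D` with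
probability at most `1 / D`. -/
structure HasFixedVectorBounds {Ω : Type*} [MeasurableSpace Ω] {m n : ℕ} (P : Measure Ω)
    (T : Ω → Matrix (Fin m) (Fin n) ℝ) (p r c Q : ℝ) : Prop where
  lower : ∀ (y : Fin n → ℝ) (ε : ℝ), 0 < ε → ε < 1 →
    P.real {ω | ellNorm r ((T ω).mulVec y) < (1 - ε) * ellNorm p y} ≤
      Real.exp (-(c * (m * ε ^ Q)))
  markov : ∀ (y : Fin n → ℝ) (D : ℝ), 1 ≤ D →
    P.real {ω | D * ellNorm p y < ellNorm r ((T ω).mulVec y)} ≤ 1 / D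

/-- The bounds for fixed vectors hold with constants that depend on the exponents and on `δ` only,
and not on the stable law. -/
lemma exists_hasFixedVectorBounds {p r q : ℝ} (hr : 1 < r) (hrp : r < p) (hp : p < 2) (hq : 1 < q)
    (hq2 : q ≤ 2) (hrq : r * q < p) :
    ∃ c : ℝ, 0 < c ∧ ∀ δ : ℝ, 0 < δ → δ < 1 → ∃ K : ℝ, 0 < K ∧ ∀ (μ : Measure ℝ), IsPStable p μ →
    ∀ (Ω : Type*) [MeasurableSpace Ω] (P : Measure Ω) [IsProbabilityMeasure P] (m n : ℕ)
      (Θ : Fin m → Fin n → Ω → ℝ), 0 < m → (∀ i j, HasLaw (Θ i j) μ P) →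
      iIndepFun (fun ij : Fin m × Fin n => Θ ij.1 ij.2) P →
      HasFixedVectorBounds P
        (fun ω => scaledMatrix r (momentConst r μ) fun i j => Θ i j ω) p r c (q / (q - 1)) ∧
      ∀ ε : ℝ, 0 < ε → K / ε ^ (q / (q - 1)) ≤ m → ∀ y : Fin n → ℝ,
        P.real {ω | (1 + ε) * ellNorm p y <
          ellNorm r ((scaledMatrix r (momentConst r μ) fun i j => Θ i j ω).mulVec y)} ≤ δ := by
  have hr0 : 0 < r := by linarith
  obtain ⟨M, hM, HM⟩ := IsPStable.exists_moment_bound hr0 (by linarith) hq.le hrq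
  refine ⟨(2 * M) ^ (-(1 / (q - 1))) / 2, by positivity, fun δ hδ hδ1 => ?_⟩
  obtain ⟨K, hK, HK⟩ := HasUnitMean.exists_measureReal_lt_sum_le hM hq hq2 hδ hδ1
  refine ⟨K, hK, ?_⟩
  intro μ hμ Ω _ P _ m n Θ hm hΘ hind
  have hm0 : (0 : ℝ) < m := by exact_mod_cast hm
  obtain ⟨hα, hI, hmean, hIq, hMq⟩ := HM μ hμ
  set α := momentConst r μ
  have hν : HasUnitMean q M (μ.map fun z => (|z| / α) ^ r) :=
    hμ.hasUnitMean_map hI hmean hα hIq hMq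
  set X : (Fin n → ℝ) → Fin m → Ω → ℝ := fun y i ω =>
    (|∑ j, Θ i j ω * y j| / (ellNorm p y * α)) ^ r
  have hX : ∀ y, y ≠ 0 → (∀ i, HasLaw (X y i) (μ.map fun z => (|z| / α) ^ r) P) ∧
      iIndepFun (X y) P := fun y hy => hμ.hasLaw_sketch (by linarith) hΘ hind hy α
  -- comparing the norm of the sketch with a multiple of `ellNorm p y` means comparing the sum
  have hlt : ∀ y : Fin n → ℝ, y ≠ 0 → ∀ t : ℝ, 0 ≤ t → ∀ ω,
      (t * ellNorm p y < ellNorm r ((scaledMatrix r α fun i j => Θ i j ω).mulVec y) ↔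
        m * t ^ r < ∑ i, X y i ω) := by
    intro y hy t ht ω
    have hs := ellNorm_pos (p := p) (by linarith) hy
    rw [← Real.rpow_lt_rpow_iff (by positivity) (ellNorm_nonneg _ hr0) hr0,
      ellNorm_scaledMatrix_mulVec_rpow hr0 hα hs hm, Real.mul_rpow ht hs.le, mul_comm (t ^ r),
      mul_lt_mul_iff_right₀ (by positivity), lt_div_iff₀ hm0, mul_comm]
  have hgt : ∀ y : Fin n → ℝ, y ≠ 0 → ∀ t : ℝ, 0 ≤ t → ∀ ω,
      (ellNorm r ((scaledMatrix r α fun i j => Θ i j ω).mulVec y) < t * ellNorm p y ↔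
        ∑ i, X y i ω < m * t ^ r) := by
    intro y hy t ht ω
    have hs := ellNorm_pos (p := p) (by linarith) hy
    rw [← Real.rpow_lt_rpow_iff (ellNorm_nonneg _ hr0) (by positivity) hr0,
      ellNorm_scaledMatrix_mulVec_rpow hr0 hα hs hm, Real.mul_rpow ht hs.le, mul_comm (t ^ r),
      mul_lt_mul_iff_right₀ (by positivity), div_lt_iff₀ hm0, mul_comm (t ^ r)]
  have hzero : ∀ ω, ellNorm r ((scaledMatrix r α fun i j => Θ i j ω).mulVec 0) = 0 := fun ω => by
    rw [Matrix.mulVec_zero, ellNorm_zero hr0]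
  have hzero' : ellNorm p (0 : Fin n → ℝ) = 0 := ellNorm_zero (by linarith)
  refine ⟨⟨?_, ?_⟩, ?_⟩
  · intro y ε hε hε1
    rcases eq_or_ne y 0 with rfl | hy
    · simp only [hzero, hzero', mul_zero, lt_irrefl, Set.ofPred_false, measureReal_empty]
      positivity
    refine (measureReal_mono fun ω hω => ?_).trans
      (hν.measureReal_sum_le hM hq hq2 (hX y hy).1 (hX y hy).2 hε)
    have h1 := (hgt y hy _ (by linarith) ω).1 hω
    have h2 : (1 - ε) ^ r ≤ 1 - ε := by
      simpa using Real.rpow_le_rpow_of_exponent_ge (by linarith) (by linarith : 1 - ε ≤ 1) hr.le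
    exact h1.le.trans (mul_le_mul_of_nonneg_left h2 hm0.le)
  · intro y D hD
    rcases eq_or_ne y 0 with rfl | hy
    · simp only [hzero, hzero', mul_zero, lt_irrefl, Set.ofPred_false, measureReal_empty]
      positivity
    have hXI : ∀ i, Integrable (X y i) P := fun i => by
      have := hν.integrable
      rw [← ((hX y hy).1 i).map_eq] at this
      exact this.comp_aemeasurable ((hX y hy).1 i).aemeasurable
    have hXE : ∀ i, ∫ ω, X y i ω ∂P = 1 := fun i => by
      rw [← hν.mean]
      exact ((hX y hy).1 i).integral_comp (f := fun w => w) aestronglyMeasurable_id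
    have h1 := mul_meas_ge_le_integral_of_nonneg (μ := P) (f := fun ω => ∑ i, X y i ω)
      (ae_of_all _ fun ω => Finset.sum_nonneg fun i _ => Real.rpow_nonneg (div_nonneg (abs_nonneg _)
        (mul_nonneg (ellNorm_nonneg _ (by linarith)) hα.le)) _)
      (integrable_finsetSum _ fun i _ => hXI i) (m * D)
    rw [integral_finsetSum _ fun i _ => hXI i] at h1
    simp only [hXE, Finset.sum_const, Finset.card_univ, Fintype.card_fin, nsmul_eq_mul,
      mul_one] at h1
    refine (measureReal_mono (s₂ := {ω | m * D ≤ ∑ i, X y i ω}) fun ω hω => ?_).trans ?_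
    · have h2 := (hlt y hy D (by linarith) ω).1 hω
      have h3 : D ≤ D ^ r := by simpa using Real.rpow_le_rpow_of_exponent_le hD hr.le
      exact (mul_le_mul_of_nonneg_left h3 hm0.le).trans h2.le
    · rw [le_div_iff₀ (by linarith)]
      have : m * (D * P.real {ω | m * D ≤ ∑ i, X y i ω}) ≤ m * 1 := by linarith
      linarith [le_of_mul_le_mul_left this hm0]
  · intro ε hε hKm y
    rcases eq_or_ne y 0 with rfl | hy
    · simp only [hzero, hzero', mul_zero, lt_irrefl, Set.ofPred_false, measureReal_empty]
      positivity
    refine (measureReal_mono fun ω hω => ?_).trans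
      (HK _ hν Ω P m (X y) (hX y hy).1 (hX y hy).2 hm ε hε hKm)
    have h1 := (hlt y hy _ (by linarith) ω).1 hω
    have h2 : 1 + ε ≤ (1 + ε) ^ r := by
      simpa using Real.rpow_le_rpow_of_exponent_le (by linarith : 1 ≤ 1 + ε) hr.le
    exact (mul_le_mul_of_nonneg_left h2 hm0.le).trans_lt h1

/-! ### Auerbach bases -/

/-- **Auerbach's lemma**: a finite-dimensional normed space has a basis in its unit ball whose
coordinate functionals have norm at most one.  Such a basis maximises the determinant over the unit
ball. -/
lemma exists_auerbach_basis (E : Type*) [NormedAddCommGroup E] [NormedSpace ℝ E]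
    [FiniteDimensional ℝ E] :
    ∃ b : Module.Basis (Fin (Module.finrank ℝ E)) ℝ E,
      (∀ i, ‖b i‖ ≤ 1) ∧ ∀ v i, |b.repr v i| ≤ ‖v‖ := by
  have : ProperSpace E := FiniteDimensional.proper_real E
  set e := Module.finBasis ℝ E
  set S : Set (Fin (Module.finrank ℝ E) → E) := Set.univ.pi fun _ => Metric.closedBall 0 1
  have hcomp : IsCompact S := isCompact_univ_pi fun _ => isCompact_closedBall 0 1
  have hcont : Continuous fun v : Fin (Module.finrank ℝ E) → E => |e.det v| := by
    refine continuous_abs.comp ?_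
    refine Continuous.matrix_det (A := fun v => e.toMatrix v) (continuous_matrix fun i j => ?_)
    exact (LinearMap.continuous_of_finiteDimensional (e.coord i)).comp (continuous_apply j)
  obtain ⟨u, hu, hmax⟩ := hcomp.exists_isMaxOn ⟨0, fun i _ => by simp⟩ hcont.continuousOn
  have hu1 : ∀ i, ‖u i‖ ≤ 1 := fun i => by simpa using hu i trivial
  have hne : e.det u ≠ 0 := by
    intro h0
    have h1 := hmax (show (fun i => ‖e i‖⁻¹ • e i) ∈ S from fun i _ => by
      have : ‖e i‖ ≠ 0 := norm_ne_zero_iff.2 (e.ne_zero i)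
      simp [norm_smul, this])
    simp only [Set.mem_ofPred_eq, h0, abs_zero, AlternatingMap.map_smul_univ, e.det_self,
      smul_eq_mul, mul_one] at h1
    have h2 : ∏ i, ‖e i‖⁻¹ ≠ 0 := Finset.prod_ne_zero_iff.2 fun i _ =>
      inv_ne_zero (norm_ne_zero_iff.2 (e.ne_zero i))
    exact h2 (abs_nonpos_iff.1 h1)
  obtain ⟨hli, hsp⟩ := e.is_basis_iff_det.2 (isUnit_iff_ne_zero.2 hne)
  set b := Module.Basis.mk hli hsp.ge
  have hbu : ∀ i, b i = u i := fun i => Module.Basis.mk_apply hli hsp.ge i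
  have hbu' : (b : Fin (Module.finrank ℝ E) → E) = u := funext hbu
  have hball : ∀ v : E, ‖v‖ ≤ 1 → ∀ i, |b.repr v i| ≤ 1 := by
    intro v hv i
    have h1 := hmax (show Function.update u i v ∈ S from fun j _ => by
      rcases eq_or_ne j i with rfl | hj
      · simpa using hv
      · simpa [hj] using hu1 j)
    -- Cramer's rule
    have h2 : e.det (Function.update u i v) = e.det u * b.repr v i := by
      rw [AlternatingMap.eq_smul_basis_det b e.det, AlternatingMap.smul_apply,
        AlternatingMap.smul_apply, smul_eq_mul, smul_eq_mul, ← hbu', b.det_self, mul_one,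
        b.det_apply, Module.Basis.toMatrix_update, Module.Basis.toMatrix_self,
        ← Matrix.cramer_apply, Matrix.cramer_one]
      rfl
    simp only [Set.mem_ofPred_eq, h2, abs_mul] at h1
    exact le_of_mul_le_mul_left (by simpa using h1) (abs_pos.2 hne)
  refine ⟨b, fun i => by rw [hbu]; exact hu1 i, fun v i => ?_⟩
  rcases eq_or_ne v 0 with rfl | hv
  · simp
  have hv0 : 0 < ‖v‖ := norm_pos_iff.2 hv
  have h1 := hball (‖v‖⁻¹ • v) (by rw [norm_smul, norm_inv, norm_norm, inv_mul_cancel₀ hv0.ne']) i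
  rw [map_smul, Finsupp.smul_apply, smul_eq_mul, abs_mul, abs_of_pos (inv_pos.2 hv0),
    inv_mul_le_iff₀ hv0, mul_one] at h1
  exact h1

lemma exists_auerbach_columns {p : ℝ} (hp : 1 ≤ p) {n d : ℕ} (A : Matrix (Fin n) (Fin d) ℝ) :
    ∃ k ≤ d, ∃ u : Fin k → Fin n → ℝ, (∀ j, ellNorm p (u j) ≤ 1) ∧
      ∀ x, ∃ c : Fin k → ℝ, A.mulVec x = ∑ j, c j • u j ∧
        ∀ j, |c j| ≤ ellNorm p (A.mulVec x) := by
  have : Fact (1 ≤ ENNReal.ofReal p) := ⟨by simpa using hp⟩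
  set φ : (Fin d → ℝ) →ₗ[ℝ] PiLp (ENNReal.ofReal p) fun _ : Fin n => ℝ :=
    (WithLp.linearEquiv (ENNReal.ofReal p) ℝ (Fin n → ℝ)).symm.toLinearMap ∘ₗ A.mulVecLin
  obtain ⟨b, hb, hrepr⟩ := exists_auerbach_basis (LinearMap.range φ)
  refine ⟨_, (LinearMap.finrank_range_le φ).trans (by simp), fun j => WithLp.ofLp (b j).1,
    fun j => hb j, fun x => ⟨b.repr ⟨φ x, LinearMap.mem_range_self φ x⟩, ?_, fun j => ?_⟩⟩
  · have h1 := congrArg (fun v => WithLp.ofLp (Subtype.val v))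
      (b.sum_repr ⟨φ x, LinearMap.mem_range_self φ x⟩)
    simp only [AddSubmonoidClass.coe_finsetSum, SetLike.val_smul, WithLp.ofLp_sum,
      WithLp.ofLp_smul] at h1
    exact h1.symm
  · exact hrepr ⟨φ x, LinearMap.mem_range_self φ x⟩ j

/-! ### Contraction of all vectors simultaneously -/

/-- A matrix which does not contract the grid points `∑ j, (g j / N) • u j`, and does not stretch
the vectors `u j` by more than `D`, contracts no vector whose coordinates are bounded by its
norm. -/
lemma le_ellNorm_mulVec_of_grid {p r : ℝ} (hp : 1 ≤ p) (hr : 1 ≤ r) {m n k N : ℕ} (hN : 0 < N)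
    (T : Matrix (Fin m) (Fin n) ℝ) (u : Fin k → Fin n → ℝ) (hu : ∀ j, ellNorm p (u j) ≤ 1)
    {D ε : ℝ} (hD : 1 ≤ D) (hε0 : 0 ≤ ε) (hε : ε ≤ 1)
    (hTu : ∀ j, ellNorm r (T.mulVec (u j)) ≤ D)
    (hgrid : ∀ g ∈ Fintype.piFinset fun _ : Fin k => Finset.Icc (-N : ℤ) N,
      (1 - ε) * ellNorm p (∑ j, ((g j : ℝ) / N) • u j) ≤
        ellNorm r (T.mulVec (∑ j, ((g j : ℝ) / N) • u j)))
    (c : Fin k → ℝ) (y : Fin n → ℝ) (hy : y = ∑ j, c j • u j) (hc : ∀ j, |c j| ≤ ellNorm p y) :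
    (1 - ε - 2 * (k * D / N)) * ellNorm p y ≤ ellNorm r (T.mulVec y) := by
  have hp0 : 0 < p := by linarith
  have hr0 : 0 < r := by linarith
  have hN0 : (0 : ℝ) < N := by exact_mod_cast hN
  rcases eq_or_ne y 0 with rfl | hy0
  · rw [ellNorm_zero hp0, mul_zero]; exact ellNorm_nonneg _ hr0
  set s := ellNorm p y
  have hs0 : 0 < s := ellNorm_pos hp hy0
  -- rounding the coordinates of `y / ‖y‖` down to the grid
  set g : Fin k → ℤ := fun j => ⌊c j / s * N⌋ with hg
  have hcs : ∀ j, |c j / s| ≤ 1 := fun j => by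
    rw [abs_div, abs_of_pos hs0]; exact (div_le_one hs0).2 (hc j)
  have hgmem : g ∈ Fintype.piFinset fun _ : Fin k => Finset.Icc (-N : ℤ) N := by
    rw [Fintype.mem_piFinset]
    intro j
    have h1 := abs_le.1 (hcs j)
    rw [Finset.mem_Icc]
    constructor
    · rw [hg, Int.le_floor]; push_cast; nlinarith
    · have : ((g j : ℤ) : ℝ) ≤ N := (Int.floor_le _).trans (by nlinarith)
      exact_mod_cast this
  set z := ∑ j, ((g j : ℝ) / N) • u j with hz
  have hdiff : y - s • z = ∑ j, (c j - s * ((g j : ℝ) / N)) • u j := by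
    rw [hy, hz, Finset.smul_sum, ← Finset.sum_sub_distrib]
    exact Finset.sum_congr rfl fun j _ => by rw [smul_smul, sub_smul]
  have hcoef : ∀ j, |c j - s * ((g j : ℝ) / N)| ≤ s / N := by
    intro j
    have h1 : c j - s * ((g j : ℝ) / N) = s / N * (c j / s * N - g j) := by field_simp
    have h2 : |c j / s * N - g j| ≤ 1 := by
      rw [abs_of_nonneg (sub_nonneg.2 (Int.floor_le _))]
      linarith [Int.lt_floor_add_one (c j / s * N)]
    rw [h1, abs_mul, abs_of_pos (by positivity)]
    exact mul_le_of_le_one_right (by positivity) h2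
  have he1 : ellNorm p (y - s • z) ≤ s * (k / N) := by
    rw [hdiff]
    refine (ellNorm_sum_le hp _ _).trans ?_
    calc _ ≤ ∑ _j : Fin k, s / N * 1 := Finset.sum_le_sum fun j _ => by
          rw [ellNorm_smul hp]
          exact mul_le_mul (hcoef j) (hu j) (ellNorm_nonneg _ hp0) (by positivity)
      _ = _ := by simp; ring
  have he2 : ellNorm r (T.mulVec (y - s • z)) ≤ s * (k * D / N) := by
    rw [hdiff, Matrix.mulVec_sum]
    refine (ellNorm_sum_le hr _ _).trans ?_
    calc _ ≤ ∑ _j : Fin k, s / N * D := Finset.sum_le_sum fun j _ => by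
          rw [Matrix.mulVec_smul, ellNorm_smul hr]
          exact mul_le_mul (hcoef j) (hTu j) (ellNorm_nonneg _ hr0) (by positivity)
      _ = _ := by simp; ring
  have h3 := hgrid g hgmem
  have h4 : s ≤ s * (k / N) + s * ellNorm p z := by
    have := ellNorm_add_le hp (y - s • z) (s • z)
    rw [sub_add_cancel, ellNorm_smul hp, abs_of_pos hs0] at this
    linarith
  have h5 : s * ellNorm r (T.mulVec z) ≤ s * (k * D / N) + ellNorm r (T.mulVec y) := by
    have := ellNorm_add_le hr ((-1 : ℝ) • T.mulVec (y - s • z)) (T.mulVec y)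
    rw [ellNorm_smul hr, Matrix.mulVec_sub, Matrix.mulVec_smul,
      show (-1 : ℝ) • (T.mulVec y - s • T.mulVec z) + T.mulVec y = s • T.mulVec z by
        rw [neg_one_smul]; abel,
      ellNorm_smul hr, abs_of_pos hs0, abs_neg, abs_one, one_mul, ← Matrix.mulVec_smul,
      ← Matrix.mulVec_sub] at this
    linarith
  have h6 : (k : ℝ) / N ≤ k * D / N := by
    gcongr; exact le_mul_of_one_le_right (by positivity) hD
  have h7 : s * ((1 - ε) * ellNorm p z) ≤ s * ellNorm r (T.mulVec z) := by gcongr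
  have h8 : (1 - ε) * s ≤ (1 - ε) * (s * (k / N) + s * ellNorm p z) := by
    apply mul_le_mul_of_nonneg_left h4; linarith
  have h9 : (1 - ε) * (s * (k / N)) ≤ s * (k * D / N) := by
    have h10 : s * ((k : ℝ) / N) ≤ s * (k * D / N) := by gcongr
    have h11 : 0 ≤ s * ((k : ℝ) / N) := by positivity
    nlinarith
  nlinarith

/-- Union bound over the vectors of an Auerbach basis and over the grid points. -/
lemma HasFixedVectorBounds.measureReal_contraction_le {Ω : Type*} [MeasurableSpace Ω]
    {P : Measure Ω} [IsProbabilityMeasure P] {m n d : ℕ} {T : Ω → Matrix (Fin m) (Fin n) ℝ}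
    {p r c Q : ℝ} (hT : HasFixedVectorBounds P T p r c Q) (hp : 1 ≤ p) (hr : 1 ≤ r)
    (A : Matrix (Fin n) (Fin d) ℝ) {D ε : ℝ} (hD : 1 ≤ D) (hε0 : 0 < ε) (hε : ε < 1) {N : ℕ}
    (hN : 0 < N) (hDN : 4 * (d * D / ε) ≤ N) :
    P.real {ω | ¬ ∀ x, (1 - ε) * ellNorm p (A.mulVec x) ≤ ellNorm r ((T ω * A).mulVec x)} ≤
      d / D + (2 * N + 1) ^ d * Real.exp (-(c * (m * (ε / 2) ^ Q))) := by
  obtain ⟨k, hkd, u, hu, hspan⟩ := exists_auerbach_columns hp A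
  have hN0 : (0 : ℝ) < N := by exact_mod_cast hN
  have hkd' : (k : ℝ) ≤ d := by exact_mod_cast hkd
  set G := Fintype.piFinset fun _ : Fin k => Finset.Icc (-N : ℤ) N with hG
  set z : (Fin k → ℤ) → Fin n → ℝ := fun g => ∑ j, ((g j : ℝ) / N) • u j with hz
  set B₁ : Fin k → Set Ω := fun j => {ω | D * ellNorm p (u j) < ellNorm r ((T ω).mulVec (u j))}
  set B₂ : (Fin k → ℤ) → Set Ω := fun g =>
    {ω | ellNorm r ((T ω).mulVec (z g)) < (1 - ε / 2) * ellNorm p (z g)}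
  have hsub : {ω | ¬ ∀ x, (1 - ε) * ellNorm p (A.mulVec x) ≤ ellNorm r ((T ω * A).mulVec x)} ⊆
      (⋃ j, B₁ j) ∪ ⋃ g ∈ G, B₂ g := by
    intro ω hω
    by_contra hcon
    rw [Set.mem_union, not_or, Set.mem_iUnion, Set.mem_iUnion₂] at hcon
    obtain ⟨hc1, hc2⟩ := hcon
    push Not at hc1 hc2
    apply hω
    intro x
    obtain ⟨c, hc, hcx⟩ := hspan x
    have h1 := le_ellNorm_mulVec_of_grid hp hr hN (T ω) u hu hD (by linarith : 0 ≤ ε / 2)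
      (by linarith)
      (fun j => (not_lt.1 (hc1 j)).trans (mul_le_of_le_one_right (by linarith) (hu j)))
      (fun g hg => not_lt.1 (hc2 g hg)) c _ hc hcx
    rw [← Matrix.mulVec_mulVec]
    refine le_trans (mul_le_mul_of_nonneg_right ?_ (ellNorm_nonneg _ (by linarith))) h1
    have h2 : (k : ℝ) * D / N ≤ ε / 4 := by
      rw [div_le_iff₀ hN0]
      have h3 : (k : ℝ) * D ≤ d * D := by gcongr
      have h4 : 4 * (d * D) ≤ N * ε := by
        rw [← mul_div_assoc, div_le_iff₀ hε0] at hDN; exact hDN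
      linarith
    linarith
  have hcard : (G.card : ℝ) ≤ (2 * N + 1) ^ d := by
    rw [hG, Fintype.card_piFinset_const, Int.card_Icc]
    have : ((N : ℤ) + 1 - -N).toNat = 2 * N + 1 := by omega
    rw [this]; push_cast
    exact pow_le_pow_right₀ (by linarith) hkd
  calc _ ≤ P.real ((⋃ j, B₁ j) ∪ ⋃ g ∈ G, B₂ g) := measureReal_mono hsub
    _ ≤ P.real (⋃ j, B₁ j) + P.real (⋃ g ∈ G, B₂ g) := measureReal_union_le _ _
    _ ≤ (∑ _j : Fin k, 1 / D) + ∑ _g ∈ G, Real.exp (-(c * (m * (ε / 2) ^ Q))) :=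
      add_le_add ((measureReal_iUnion_fintype_le _).trans
          (Finset.sum_le_sum fun j _ => hT.markov (u j) D hD))
        ((measureReal_biUnion_finset_le _ _).trans
          (Finset.sum_le_sum fun g _ => hT.lower (z g) (ε / 2) (by linarith) (by linarith)))
    _ ≤ _ := by
      simp only [Finset.sum_const, Finset.card_univ, Fintype.card_fin, nsmul_eq_mul, mul_one_div]
      gcongr

/-- The grid has `exp (O (d * log (d / ε)))` points, so the exponential bounds for the single
points survive the union bound once `m` is a large multiple of `d * log d / ε ^ (Q + 1)`. -/
lemma HasFixedVectorBounds.measureReal_contraction_le_rpow {Ω : Type*} [MeasurableSpace Ω]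
    {P : Measure Ω} [IsProbabilityMeasure P] {m n d : ℕ} {T : Ω → Matrix (Fin m) (Fin n) ℝ}
    {p r c Q : ℝ} (hT : HasFixedVectorBounds P T p r c Q) (hp : 1 ≤ p) (hr : 1 ≤ r) (hc : 0 < c)
    (A : Matrix (Fin n) (Fin d) ℝ) (hd : 2 ≤ d) {b ε : ℝ} (hb : 0 < b) (hε0 : 0 < ε) (hε : ε < 1)
    (hm : (2 * b + 13) * 2 ^ Q / c * (d * Real.log d) / ε ^ (Q + 1) ≤ m) :
    P.real {ω | ¬ ∀ x, (1 - ε) * ellNorm p (A.mulVec x) ≤ ellNorm r ((T ω * A).mulVec x)} ≤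
      (d : ℝ) ^ (-b) := by
  have hd2 : (2 : ℝ) ≤ d := by exact_mod_cast hd
  have hd0 : (0 : ℝ) < d := by linarith
  have hlog2 : (1 : ℝ) / 2 ≤ Real.log 2 := by linarith [Real.log_two_gt_d9]
  have hlog2d : Real.log 2 ≤ Real.log d := Real.log_le_log two_pos hd2
  set D : ℝ := 2 * (d : ℝ) ^ (b + 1) with hDdef
  have hdb : 1 ≤ (d : ℝ) ^ (b + 1) := Real.one_le_rpow (by linarith) (by linarith)
  have hD1 : 1 ≤ D := by linarith
  set N := ⌈4 * (d * D / ε)⌉₊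
  have hNpos : 0 < N := Nat.ceil_pos.2 (by positivity)
  refine (hT.measureReal_contraction_le hp hr A hD1 hε0 hε hNpos (Nat.le_ceil _)).trans ?_
  have h1 : (d : ℝ) / D = (d : ℝ) ^ (-b) / 2 := by
    rw [hDdef, Real.rpow_add hd0, Real.rpow_one, Real.rpow_neg hd0.le]; field_simp
  -- the number of grid points
  have hX : (2 * (N : ℝ) + 1) ≤ 22 * (d : ℝ) ^ (b + 2) / ε := by
    have h2 : (N : ℝ) < 4 * (d * D / ε) + 1 := Nat.ceil_lt_add_one (by positivity)
    have h3 : 1 ≤ d * D / ε := by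
      rw [le_div_iff₀ hε0]; nlinarith
    have h4 : d * D / ε = 2 * (d : ℝ) ^ (b + 2) / ε := by
      rw [hDdef, show b + 2 = b + 1 + 1 by ring, Real.rpow_add hd0 (b + 1), Real.rpow_one]; ring
    have h5 : 22 * (d : ℝ) ^ (b + 2) / ε = 11 * (d * D / ε) := by rw [h4]; ring
    rw [h5]; linarith
  have hlogε : Real.log ε⁻¹ ≤ ε⁻¹ :=
    (Real.log_le_sub_one_of_pos (by positivity)).trans (by linarith)
  have hε1 : 1 ≤ ε⁻¹ := (one_le_inv₀ hε0).2 hε.le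
  have hlogX : Real.log (2 * N + 1) ≤ (12 + b) * (Real.log d * ε⁻¹) := by
    refine (Real.log_le_log (by positivity) hX).trans ?_
    rw [div_eq_mul_inv, Real.log_mul (by positivity) (by positivity),
      Real.log_mul (by norm_num) (by positivity), Real.log_rpow hd0]
    have h22 : Real.log 22 ≤ 8 * Real.log 2 := by
      rw [← Real.log_rpow two_pos]
      exact Real.log_le_log (by norm_num) (by norm_num)
    have h5 : Real.log d ≤ Real.log d * ε⁻¹ := le_mul_of_one_le_right (by linarith) hε1
    have h6 : ε⁻¹ ≤ 2 * (Real.log d * ε⁻¹) := by nlinarith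
    nlinarith
  have hmain : d * Real.log (2 * N + 1) + b * Real.log d + Real.log 2 ≤
      c * (m * (ε / 2) ^ Q) := by
    have h5 : Real.log d ≤ d * (Real.log d * ε⁻¹) := by
      have : Real.log d ≤ Real.log d * ε⁻¹ := le_mul_of_one_le_right (by linarith) hε1
      nlinarith
    have h6 : (2 * b + 13) * (d * (Real.log d * ε⁻¹)) ≤ c * (m * (ε / 2) ^ Q) := by
      have h7 := mul_le_mul_of_nonneg_right hm
        (show 0 ≤ c * (ε / 2) ^ Q by positivity)
      calc _ = (2 * b + 13) * 2 ^ Q / c * (d * Real.log d) / ε ^ (Q + 1) * (c * (ε / 2) ^ Q) := by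
            rw [Real.rpow_add hε0, Real.rpow_one, Real.div_rpow hε0.le two_pos.le]
            field_simp
        _ ≤ _ := h7
        _ = _ := by ring
    have h8 : d * Real.log (2 * N + 1) ≤ d * ((12 + b) * (Real.log d * ε⁻¹)) := by gcongr
    have h9 : b * Real.log d ≤ b * (d * (Real.log d * ε⁻¹)) := by gcongr
    linarith
  have h2 : (2 * (N : ℝ) + 1) ^ d * Real.exp (-(c * (m * (ε / 2) ^ Q))) ≤ (d : ℝ) ^ (-b) / 2 := by
    have h10 : (2 * (N : ℝ) + 1) ^ d = Real.exp (d * Real.log (2 * N + 1)) := by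
      rw [Real.exp_nat_mul, Real.exp_log (by positivity)]
    have h11 : (d : ℝ) ^ (-b) / 2 = Real.exp (-(b * Real.log d) - Real.log 2) := by
      rw [Real.exp_sub, Real.exp_log two_pos, Real.rpow_def_of_pos hd0]
      congr 2; ring
    rw [h10, h11, ← Real.exp_add, Real.exp_le_exp]
    linarith
  rw [h1]; linarith

/-! ### Rounding -/

lemma ellNorm_roundMatrix_sub_le {p r η : ℝ} (hp : 1 ≤ p) (hr : 1 ≤ r) (hη : 0 < η) {m n : ℕ}
    (T : Matrix (Fin m) (Fin n) ℝ) (y : Fin n → ℝ) :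
    ellNorm r ((roundMatrix η T - T).mulVec y) ≤ m * n * η / 2 * ellNorm p y := by
  have hs : 0 ≤ ellNorm p y := ellNorm_nonneg y (by linarith)
  have h1 : ∀ i, |(roundMatrix η T - T).mulVec y i| ≤ n * (η / 2 * ellNorm p y) := by
    intro i
    rw [Matrix.mulVec, dotProduct]
    refine (Finset.abs_sum_le_sum_abs _ _).trans ?_
    have h2 : ∀ j ∈ Finset.univ, |(roundMatrix η T - T) i j * y j| ≤ η / 2 * ellNorm p y := by
      intro j _
      rw [abs_mul]
      refine mul_le_mul ?_ (abs_le_ellNorm hp y j) (abs_nonneg _) (by positivity)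
      have h3 : (roundMatrix η T - T) i j = -((T i j / η - round (T i j / η)) * η) := by
        simp only [Matrix.sub_apply, roundMatrix, Matrix.of_apply]
        field_simp
        ring
      rw [h3, abs_neg, abs_mul, abs_of_pos hη]
      have := abs_sub_round (T i j / η)
      nlinarith
    refine (Finset.sum_le_sum h2).trans ?_
    simp
  refine (ellNorm_le_card_mul hr h1).trans (le_of_eq ?_)
  rw [Fintype.card_fin]; ring

lemma one_sub_le_measureReal_of_compl_le {Ω : Type*} [MeasurableSpace Ω] {P : Measure Ω}
    [IsProbabilityMeasure P] {E : Set Ω} {δ : ℝ} (h : P.real Eᶜ ≤ δ) : 1 - δ ≤ P.real E := by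
  have h1 := measureReal_union_le (μ := P) E Eᶜ
  rw [Set.union_compl_self, probReal_univ] at h1
  linarith

/-- A lopsided embedding with accuracy `ε / 2` can be perturbed by matrices of norm at most `ε / 2`
from `ℓ_p` to `ℓ_r`.  No measurability of the events is needed, because their complements are
bounded in outer measure. -/
lemma isLopsidedEmbedding_of_perturbation {Ω : Type*} [MeasurableSpace Ω] {P : Measure Ω}
    [IsProbabilityMeasure P] {m n d : ℕ} {T T' : Ω → Matrix (Fin m) (Fin n) ℝ}
    {A : Matrix (Fin n) (Fin d) ℝ} {p r ε δ₁ δ₂ : ℝ} (hr : 1 ≤ r)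
    (hdil : ∀ y, P.real {ω | (1 + ε / 2) * ellNorm p y < ellNorm r ((T ω).mulVec y)} ≤ δ₁)
    (hcon : P.real {ω | ¬ ∀ x, (1 - ε / 2) * ellNorm p (A.mulVec x) ≤
      ellNorm r ((T ω * A).mulVec x)} ≤ δ₂)
    (hT : ∀ ω y, ellNorm r ((T' ω - T ω).mulVec y) ≤ ε / 2 * ellNorm p y) :
    IsLopsidedEmbedding P T' A p r ε δ₁ δ₂ := by
  refine ⟨fun x => one_sub_le_measureReal_of_compl_le ?_, one_sub_le_measureReal_of_compl_le ?_⟩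
  · refine (measureReal_mono fun ω hω => ?_).trans (hdil (A.mulVec x))
    have h0 : (1 + ε) * ellNorm p (A.mulVec x) < ellNorm r ((T' ω * A).mulVec x) := not_le.1 hω
    have h1 := ellNorm_add_le hr ((T' ω - T ω).mulVec (A.mulVec x)) ((T ω).mulVec (A.mulVec x))
    rw [← Matrix.add_mulVec, sub_add_cancel] at h1
    rw [← Matrix.mulVec_mulVec] at h0
    have h2 := hT ω (A.mulVec x)
    change (1 + ε / 2) * ellNorm p (A.mulVec x) < ellNorm r ((T ω).mulVec (A.mulVec x))
    linarith
  · refine (measureReal_mono fun ω hω => ?_).trans hcon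
    intro hall
    apply hω
    intro x
    have h0 := hall x
    have h1 := ellNorm_add_le hr ((-1 : ℝ) • (T' ω - T ω).mulVec (A.mulVec x))
      ((T' ω).mulVec (A.mulVec x))
    rw [ellNorm_smul hr, abs_neg, abs_one, one_mul, Matrix.sub_mulVec,
      show (-1 : ℝ) • ((T' ω).mulVec (A.mulVec x) - (T ω).mulVec (A.mulVec x)) +
        (T' ω).mulVec (A.mulVec x) = (T ω).mulVec (A.mulVec x) by rw [neg_one_smul]; abel,
      ← Matrix.sub_mulVec] at h1
    rw [← Matrix.mulVec_mulVec] at h0 ⊢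
    have h2 := hT ω (A.mulVec x)
    linarith

/-- Since the number of rows is polynomial in `d / ε`, a polynomially small precision makes the
accumulated rounding error at most `ε`. -/
lemma mul_precision_le {L ε η : ℝ} {n d m l : ℕ} (hl : L ≤ l) (hε : 0 < ε) (hε1 : ε < 1)
    (hd : 2 ≤ d) (hm : (m : ℝ) ≤ L * (d * Real.log d) / ε ^ L) (hη0 : 0 < η)
    (hη : η ≤ (ε / (n * d)) ^ (l + 2)) : m * n * η ≤ ε := by
  have hd2 : (2 : ℝ) ≤ d := by exact_mod_cast hd
  have hd0 : (0 : ℝ) < d := by linarith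
  have hn : 0 < n := by
    rcases Nat.eq_zero_or_pos n with rfl | hn
    · simp at hη; linarith
    · exact hn
  have hn1 : (1 : ℝ) ≤ n := by exact_mod_cast hn
  have hlog0 : 0 ≤ Real.log d := Real.log_nonneg (by linarith)
  have hlogd : Real.log d ≤ d := Real.log_le_self hd0.le
  have h1 : (m : ℝ) ≤ l * (d * d) / ε ^ l := by
    refine hm.trans ?_
    have h2 : L * (d * Real.log d) ≤ l * (d * d) := by
      calc L * (d * Real.log d) ≤ l * (d * Real.log d) := by gcongr
        _ ≤ _ := by gcongr
    have h3 : ε ^ l ≤ ε ^ L := by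
      rw [← Real.rpow_natCast]
      exact Real.rpow_le_rpow_of_exponent_ge hε hε1.le hl
    exact div_le_div₀ (by positivity) h2 (by positivity) h3
  have h4 : (l : ℝ) ≤ (d : ℝ) ^ l := by
    have : l ≤ d ^ l := (Nat.lt_pow_self (by omega)).le
    exact_mod_cast this
  have h5 : (ε / (n * d)) ^ (l + 2) ≤ ε ^ (l + 1) / (n * (d ^ l * (d * d))) := by
    rw [div_pow, mul_pow]
    have h6 : ε ^ (l + 2) ≤ ε ^ (l + 1) := pow_le_pow_of_le_one hε.le hε1.le (by omega)
    have h7 : (n : ℝ) ≤ (n : ℝ) ^ (l + 2) := le_self_pow₀ hn1 (by omega)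
    have h8 : (d : ℝ) ^ l * (d * d) = (d : ℝ) ^ (l + 2) := by ring
    rw [h8]
    gcongr
  calc m * n * η ≤ (l * (d * d) / ε ^ l) * n * (ε ^ (l + 1) / (n * (d ^ l * (d * d)))) := by
        gcongr
        exact hη.trans h5
    _ = l / d ^ l * ε := by
        rw [pow_succ]; field_simp
    _ ≤ 1 * ε := by
        gcongr
        exact (div_le_one (by positivity)).2 h4
    _ = ε := one_mul ε

theorem mainTheorem5 (p r : ℝ) (hr : 1 < r) (hrp : r < p) (hp : p < 2) :
    ∃ C : ℝ, 0 < C ∧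
    ∀ δ b : ℝ, 0 < δ → δ < 1 → 0 < b → ∃ K : ℝ, 0 < K ∧
    ∀ L : ℝ, ∃ c : ℕ,
    ∀ (ε : ℝ), 0 < ε → ε < 1 →
    ∀ (n d m : ℕ), 2 ≤ d →
      K * (d * Real.log d) / ε ^ C ≤ m →
      (m : ℝ) ≤ L * (d * Real.log d) / ε ^ L →
    ∀ (A : Matrix (Fin n) (Fin d) ℝ)
      (μ : Measure ℝ), IsPStable p μ →
    ∀ (Ω : Type*) [MeasurableSpace Ω] (P : Measure Ω) [IsProbabilityMeasure P]
      (Θ : Fin m → Fin n → Ω → ℝ),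
      (∀ i j, HasLaw (Θ i j) μ P) →
      iIndepFun (fun (ij : Fin m × Fin n) => Θ ij.1 ij.2) P →
      IsLopsidedEmbedding P
        (fun ω => scaledMatrix r (momentConst r μ) (fun i j => Θ i j ω))
        A p r ε δ ((d : ℝ) ^ (-b)) ∧
      ∀ η : ℝ, 0 < η → η ≤ (ε / (n * d)) ^ c →
        IsLopsidedEmbedding P
          (fun ω => roundMatrix η (scaledMatrix r (momentConst r μ) (fun i j => Θ i j ω)))
          A p r ε δ ((d : ℝ) ^ (-b)) := by
  -- any exponent `q` with `1 < q < p / r` works: `|Z| ^ r` has finite moments of order `q`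
  set q : ℝ := (1 + p / r) / 2 with hqdef
  have hr0 : 0 < r := by linarith
  have hpr : 1 < p / r := (one_lt_div hr0).2 hrp
  have hpr2 : p / r ≤ 2 := (div_le_iff₀ hr0).2 (by linarith)
  have hq : 1 < q := by rw [hqdef]; linarith
  have hq2 : q ≤ 2 := by rw [hqdef]; linarith
  have hrq : r * q < p := by
    have : r * (p / r) = p := mul_div_cancel₀ p hr0.ne'
    rw [hqdef]; linarith
  have hQ : 0 < q / (q - 1) := div_pos (by linarith) (by linarith)
  obtain ⟨c₀, hc₀, H⟩ := exists_hasFixedVectorBounds hr hrp hp hq hq2 hrq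
  set Q := q / (q - 1)
  refine ⟨Q + 1, by linarith, fun δ b hδ hδ1 hb => ?_⟩
  obtain ⟨K₀, hK₀, HK⟩ := H δ hδ hδ1
  set K₁ := (2 * b + 13) * 2 ^ Q / c₀
  have hK₁ : 0 < K₁ := by positivity
  refine ⟨2 ^ (Q + 1) * (K₁ + K₀), by positivity, fun L => ⟨⌈L⌉₊ + 2, ?_⟩⟩
  intro ε hε hε1 n d m hd hm hmL A μ hμ Ω _ P _ Θ hΘ hind
  have hd2 : (2 : ℝ) ≤ d := by exact_mod_cast hd
  have hlog : Real.log 2 ≤ Real.log d := Real.log_le_log two_pos hd2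
  have hdlog : 1 ≤ d * Real.log d := by nlinarith [Real.log_two_gt_d9]
  have hm' : (K₁ + K₀) * (d * Real.log d) / (ε / 2) ^ (Q + 1) ≤ m := by
    refine le_trans (le_of_eq ?_) hm
    rw [Real.div_rpow hε.le two_pos.le]; field_simp
  have hm0 : 0 < m := by
    have : (0 : ℝ) < m := lt_of_lt_of_le (by positivity) hm'
    exact_mod_cast this
  have hm₁ : K₁ * (d * Real.log d) / (ε / 2) ^ (Q + 1) ≤ m := by
    refine le_trans ?_ hm'
    gcongr
    linarith
  have hm₀ : K₀ / (ε / 2) ^ Q ≤ m := by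
    refine le_trans ?_ hm'
    have h1 : (ε / 2) ^ (Q + 1) ≤ (ε / 2) ^ Q :=
      Real.rpow_le_rpow_of_exponent_ge (by linarith) (by linarith) (by linarith)
    have h2 : K₀ ≤ (K₁ + K₀) * (d * Real.log d) := by nlinarith
    exact div_le_div₀ (by positivity) h2 (by positivity) h1
  obtain ⟨hbounds, hup⟩ := HK μ hμ Ω P m n Θ hm0 hΘ hind
  have hdil := hup (ε / 2) (by linarith) hm₀
  have hcon := hbounds.measureReal_contraction_le_rpow (by linarith) hr.le hc₀ A hd hb
    (by linarith : 0 < ε / 2) (by linarith) hm₁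
  refine ⟨isLopsidedEmbedding_of_perturbation hr.le hdil hcon fun ω y => ?_,
    fun η hη0 hη => isLopsidedEmbedding_of_perturbation hr.le hdil hcon fun ω y => ?_⟩
  · rw [sub_self, Matrix.zero_mulVec, ellNorm_zero hr0]
    exact mul_nonneg (by linarith) (ellNorm_nonneg y (by linarith))
  · refine (ellNorm_roundMatrix_sub_le (by linarith : 1 ≤ p) hr.le hη0 _ y).trans ?_
    have h1 := mul_precision_le (Nat.le_ceil L) hε hε1 hd hmL hη0 hη
    exact mul_le_mul_of_nonneg_right (by linarith) (ellNorm_nonneg y (by linarith))
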